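/- **Setting.** A hexagonal system $(\mathbb J,\mathbb F,\#)$ consists of a commutative field $\mathbb F$, an $\mathbb F$-vector space $\mathbb J$ and a map $\#:\mathbb J\to\mathbb J$, together with the norm $\mathsf N:\mathbb J\to\mathbb F$, symmetric bilinear maps $\mathsf T:\mathbb J\times\mathbb J\to\mathbb F$ and $\times:\mathbb J\times\mathbb J\to\mathbb J$ and an element $1\in\mathbb J\setminus\{0\}$ such that for all $t\in\mathbb F$ and $a,b,c\in\mathbb J$: $(ta)^\#=t^2a^\#$; $\mathsf N(ta)=t^3\mathsf N(a)$; $\mathsf T(a,b\times c)=\mathsf T(a\times b,c)$; $(a+b)^\#=a^\#+a\times b+b^\#$; $\mathsf N(a+b)=\mathsf N(a)+\mathsf T(a^\#,b)+\mathsf T(a,b^\#)+\mathsf N(b)$; $\mathsf T(a,a^\#)=3\mathsf N(a)$; $a^{\#\#}=\mathsf N(a)a$; $a^\#\times(a\times b)=\mathsf N(a)b+\mathsf T(a^\#,b)a$; $a^\#\times b^\#+(a\times b)^\#=\mathsf T(a^\#,b)b+\mathsf T(a,b^\#)a$; $1^\#=1$; $b=\mathsf T(b,1)1-1\times b$; $\mathsf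 N(a)=0\iff a=0$. Let $\Gamma$ be a Moufang hexagon (a thick generalised hexagon satisfying the Moufang condition) with full collineation group $G$, and let $v_i$ ($i\in\mathbb Z/12$) be the elements of an ordinary hexagon $A_0$ of $\Gamma$ in cyclic order, where $p_0=v_7$ is a point and $L_0=v_6$ is a line. Let $U_i\le G$ be the root group of the path $(v_i,\dots,v_{i+6})$, that is, the group of all collineations fixing every element incident with one of $v_{i+1},\dots,v_{i+5}$. Suppose that $\Gamma$ is associated to the hexagonal system $(\mathbb J,\mathbb F,\#)$, that is, there are isomorphisms $x_i:(\mathbb J,+)\to U_i$ for $i=1,3,5$ and $x_i:(\mathbb F,+)\to U_i$ for $i=2,4,6$ such that, with $[g,h]=g^{-1}h^{-1}gh$, $$[x_1(a),x_3(b)]=x_2(\mathsf T(a,b)),\qquad [x_3(a),x_5(b)]=x_4(\mathsf T(a,b)),\qquad [x_2(t),x_6(u)]=x_4(tu),$$ $$[x_1(a),x_5(b)]=x_2(-\mathsf T(a^\#,b))\,x_3(a\times b)\,x_4(\mathsf T(a,b^\#)),$$ $$[x_1(a),x_6(t)]=x_2(-t\mathsf N(a))\,x_3(ta^\#)\,x_4(t^2\mathsf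 N(a))\,x_5(-ta),$$ and $[U_i,U_j]=1$ for all other pairs $1\le i<j\le 6$. **Theorem.** There are $s_1,s_6\in G$ that stabilise $A_0$ and induce on it the reflections $v_j\mapsto v_{14-j}$ (fixing $p_0$) and $v_j\mapsto v_{12-j}$ (fixing $L_0$), respectively. For any such $s_1,s_6$, and for $t,t',t'',u,u'\in\mathbb F$ and $a,a',b,b',b''\in\mathbb J$, define points $$(\infty)=p_0,\quad (t)=x_6(t)s_6\,p_0,\quad (b,u)=x_1(b)x_2(u)s_1s_6\,p_0,\quad (t,a,t')=x_6(t)x_5(a)x_4(t')s_6s_1s_6\,p_0,$$ $$(b,u,b',u')=x_1(b)x_2(u)x_3(b')x_4(u')s_1s_6s_1s_6\,p_0,\quad (t,a,t',a',t'')=x_6(t)x_5(a)x_4(t')x_3(a')x_2(t'')s_6s_1s_6s_1s_6\,p_0$$ and lines $$[\infty]=L_0,\quad [b]=x_1(b)s_1\,L_0,\quad [t,a]=x_6(t)x_5(a)s_6s_1\,L_0,\quad [b,u,b']=x_1(b)x_2(u)x_3(b')s_1s_6s_1\,L_0,$$ $$[t,a,t',a']=x_6(t)x_5(a)x_4(t')x_3(a')s_6s_1s_6s_1\,L_0,\quad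 [b,u,b',u',b'']=x_1(b)x_2(u)x_3(b')x_4(u')x_5(b'')s_1s_6s_1s_6s_1\,L_0.$$ Then every point and every line of $\Gamma$ has exactly one such label, and the incidence relation $*$ is given as follows. One has $$(t,a,t',a',t'')*[t,a,t',a']*(t,a,t')*[t,a]*(t)*[\infty]*(\infty)*[b]*(b,u)*[b,u,b']*(b,u,b',u')*[b,u,b',u',b''],$$ and, apart from pairs consisting of a point labelled by a $5$-tuple and a line labelled by a $5$-tuple, there are no other incidences. Moreover $(t,a,t',a',t'')*[b,u,b',u',b'']$ if and only if $$\begin{aligned}u&=t''+t\mathsf N(b)-\mathsf T(a',b)+\mathsf T(a,b^\#)\\ b'&=a'-(a\times b)-tb^\#\\ u'&=t'+t^2\mathsf N(b)-tt''+t\mathsf T(a,b^\#)+\mathsf T(a^\#,b)-\mathsf T(a,a')\\ b''&=a+tb,\end{aligned}$$ if and only if $$\begin{aligned}a&=b''-tb\\ t'&=u'+t^2\mathsf N(b)+ut-t\mathsf T(b'',b^\#)+\mathsf T(b',b'')+\mathsf T(b''^\#,b)\\ a'&=b'+b\times b''-tb^\#\\ t''&=u-t\mathsf N(b)+\mathsf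 T(b,b')+\mathsf T(b'',b^\#).\end{aligned}$$ -/

import Mathlib

/-- A hexagonal system `(J, F, #)`: the adjoint `#`, together with the norm `N`, the trace form `T`,
the symmetric bilinear product `×` and the identity element that belong to it. -/
structure HexagonalSystem (F J : Type*) [Field F] [AddCommGroup J] [Module F J] where
  /-- the norm -/
  N : J → F
  /-- the adjoint, written `a ↦ a^#` -/
  sharp : J → J
  /-- the trace form -/
  T : J →ₗ[F] J →ₗ[F] F
  /-- the product, written `a × b` -/
  cross : J →ₗ[F] J →ₗ[F] J
  /-- the identity element -/
  one : J
  one_ne_zero : one ≠ 0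
  T_symm : ∀ a b, T a b = T b a
  cross_symm : ∀ a b, cross a b = cross b a
  sharp_smul : ∀ (t : F) (a : J), sharp (t • a) = t ^ 2 • sharp a
  N_smul : ∀ (t : F) (a : J), N (t • a) = t ^ 3 * N a
  T_cross : ∀ a b c, T a (cross b c) = T (cross a b) c
  sharp_add : ∀ a b, sharp (a + b) = sharp a + cross a b + sharp b
  N_add : ∀ a b, N (a + b) = N a + T (sharp a) b + T a (sharp b) + N b
  T_sharp : ∀ a, T a (sharp a) = 3 * N a
  sharp_sharp : ∀ a, sharp (sharp a) = N a • a
  sharp_cross_cross : ∀ a b, cross (sharp a) (cross a b) = N a • b + T (sharp a) b • a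
  sharp_cross_sharp : ∀ a b,
    cross (sharp a) (sharp b) + sharp (cross a b) = T (sharp a) b • b + T a (sharp b) • a
  sharp_one : sharp one = one
  eq_trace_sub : ∀ b, b = T b one • one - cross one b
  N_eq_zero : ∀ a, N a = 0 ↔ a = 0

/-- A point-line geometry with point set `P` and line set `L`. -/
structure PointLineGeometry (P L : Type*) where
  /-- incidence of a point with a line -/
  Inc : P → L → Prop

namespace PointLineGeometry

variable {P L : Type*} (Γ : PointLineGeometry P L)

/-- Adjacency of two elements (points or lines) in the incidence graph. -/
def Adj : P ⊕ L → P ⊕ L → Prop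
  | Sum.inl p, Sum.inr l => Γ.Inc p l
  | Sum.inr l, Sum.inl p => Γ.Inc p l
  | _, _ => False

/-- The elements `v 0, v 1, …, v (2k - 1)`, in this cyclic order, form an ordinary `k`-gon
(with `k ≥ 2`). -/
def IsOrdinaryGon (k : ℕ) (v : ZMod (2 * k) → P ⊕ L) : Prop :=
  Function.Injective v ∧ ∀ i, Γ.Adj (v i) (v (i + 1))

/-- Generalised hexagons: nonempty geometries without ordinary `2`-, `3`-, `4`- and `5`-gons in
which any two elements lie in a common ordinary hexagon. -/
def IsGeneralisedHexagon : Prop :=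
  Nonempty (P ⊕ L) ∧
  (∀ k, 2 ≤ k → k ≤ 5 → ∀ v : ZMod (2 * k) → P ⊕ L, ¬ Γ.IsOrdinaryGon k v) ∧
  (∀ x y : P ⊕ L, ∃ v : ZMod (2 * 6) → P ⊕ L,
    Γ.IsOrdinaryGon 6 v ∧ x ∈ Set.range v ∧ y ∈ Set.range v)

/-- Each line contains at least three points and each point is on at least three lines. -/
def IsThick : Prop :=
  (∀ l, 3 ≤ {p | Γ.Inc p l}.encard) ∧ (∀ p, 3 ≤ {l | Γ.Inc p l}.encard)

/-- The full collineation group: pairs of a permutation of the points and a permutation of the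
lines which preserve incidence in both directions. -/
def collineationGroup : Subgroup (Equiv.Perm P × Equiv.Perm L) where
  carrier := {g | ∀ p l, Γ.Inc (g.1 p) (g.2 l) ↔ Γ.Inc p l}
  one_mem' := fun _ _ => Iff.rfl
  mul_mem' := fun {g h} hg hh p l => (hg (h.1 p) (h.2 l)).trans (hh p l)
  inv_mem' := fun {g} hg p l => by
    have h := hg (g.1⁻¹ p) (g.2⁻¹ l)
    rw [show g.1 (g.1⁻¹ p) = p from g.1.apply_symm_apply p,
      show g.2 (g.2⁻¹ l) = l from g.2.apply_symm_apply l] at h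
    exact h.symm

/-- A collineation. -/
abbrev Collineation := Γ.collineationGroup

variable {Γ}

/-- The image of a point under a collineation. -/
def Collineation.onPoint (g : Γ.Collineation) (p : P) : P := g.1.1 p

/-- The image of a line under a collineation. -/
def Collineation.onLine (g : Γ.Collineation) (l : L) : L := g.1.2 l

/-- The image of an element (a point or a line) under a collineation. -/
def Collineation.act (g : Γ.Collineation) : P ⊕ L → P ⊕ L :=
  Sum.map (Collineation.onPoint g) (Collineation.onLine g)

variable (Γ)

/-- The root group of a path `γ 0, …, γ 6`: all collineations fixing every element that is
incident with one of the inner elements `γ 1, …, γ 5`. -/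
def rootGroup (γ : Fin 7 → P ⊕ L) : Subgroup Γ.Collineation where
  carrier := {g | ∀ i, 0 < i → i < 6 → ∀ y, Γ.Adj (γ i) y → Collineation.act g y = y}
  one_mem' := fun _ _ _ y _ => by cases y <;> rfl
  mul_mem' := fun {g h} hg hh i h0 h6 y hy => by
    have e : Collineation.act (g * h) y = Collineation.act g (Collineation.act h y) := by
      cases y <;> rfl
    rw [e, hh i h0 h6 y hy, hg i h0 h6 y hy]
  inv_mem' := fun {g} hg i h0 h6 y hy => by
    have e : Collineation.act g⁻¹ (Collineation.act g y) = y := by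
      cases y
      · exact congrArg Sum.inl (g.1.1.symm_apply_apply _)
      · exact congrArg Sum.inr (g.1.2.symm_apply_apply _)
    rwa [hg i h0 h6 y hy] at e

/-- A root: a path of length six in the incidence graph without repeated elements. -/
def IsRoot (γ : Fin 7 → P ⊕ L) : Prop :=
  Function.Injective γ ∧ ∀ i : Fin 6, Γ.Adj (γ i.castSucc) (γ i.succ)

/-- Moufang hexagons: thick generalised hexagons in which the root group of every root
`(γ 0, …, γ 6)` is transitive on the elements incident with `γ 0` and different from `γ 1`. -/
def IsMoufangHexagon : Prop :=
  Γ.IsGeneralisedHexagon ∧ Γ.IsThick ∧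
  ∀ γ : Fin 7 → P ⊕ L, Γ.IsRoot γ →
    ∀ y y', Γ.Adj (γ 0) y → y ≠ γ 1 → Γ.Adj (γ 0) y' → y' ≠ γ 1 →
      ∃ g ∈ Γ.rootGroup γ, Collineation.act g y = y'

end PointLineGeometry

/-- The commutator `[g, h] = g⁻¹ h⁻¹ g h`. -/
def rootCommutator {G : Type*} [Group G] (g h : G) : G := g⁻¹ * h⁻¹ * g * h

/-- `x : A → G` is an isomorphism of the additive group `A` with the subgroup `U` of `G`. -/
def ParametrisesSubgroup {A G : Type*} [AddGroup A] [Group G] (x : A → G) (U : Subgroup G) : Prop :=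
  (∀ a b, x (a + b) = x a * x b) ∧ Function.Injective x ∧ Set.range x = (U : Set G)

/-- What it means that the geometry `Γ` is associated to the hexagonal system `H`: an apartment
`v 0, …, v 11` of `Γ` (an ordinary hexagon) containing the base chamber `{p₀, L₀}`, where
`p₀ = v 7` and `L₀ = v 6`, and parametrisations `x₁, …, x₆` of the six positive root groups
`U₁, …, U₆` that satisfy the commutator relations defined by `H`. Here `U_i` is the root group of
the path `(v i, …, v (i + 6))`; these are the roots of the apartment that contain the base chamber.
So `U₁` acts on the lines through `p₀` and `U₆` acts on the points on `L₀`. -/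
structure HexagonLabelling {P L F J : Type*} [Field F] [AddCommGroup J] [Module F J]
    (Γ : PointLineGeometry P L) (H : HexagonalSystem F J) where
  /-- the base apartment -/
  v : ZMod (2 * 6) → P ⊕ L
  /-- the base point -/
  p₀ : P
  /-- the base line -/
  L₀ : L
  apartment : Γ.IsOrdinaryGon 6 v
  v_seven : v 7 = Sum.inl p₀
  v_six : v 6 = Sum.inr L₀
  /-- parametrisation of `U₁` -/
  x₁ : J → Γ.Collineation
  /-- parametrisation of `U₂` -/
  x₂ : F → Γ.Collineation
  /-- parametrisation of `U₃` -/
  x₃ : J → Γ.Collineation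
  /-- parametrisation of `U₄` -/
  x₄ : F → Γ.Collineation
  /-- parametrisation of `U₅` -/
  x₅ : J → Γ.Collineation
  /-- parametrisation of `U₆` -/
  x₆ : F → Γ.Collineation
  param₁ : ParametrisesSubgroup x₁ (Γ.rootGroup fun k => v (1 + (k : ℕ)))
  param₂ : ParametrisesSubgroup x₂ (Γ.rootGroup fun k => v (2 + (k : ℕ)))
  param₃ : ParametrisesSubgroup x₃ (Γ.rootGroup fun k => v (3 + (k : ℕ)))
  param₄ : ParametrisesSubgroup x₄ (Γ.rootGroup fun k => v (4 + (k : ℕ)))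
  param₅ : ParametrisesSubgroup x₅ (Γ.rootGroup fun k => v (5 + (k : ℕ)))
  param₆ : ParametrisesSubgroup x₆ (Γ.rootGroup fun k => v (6 + (k : ℕ)))
  comm₁₃ : ∀ a b, rootCommutator (x₁ a) (x₃ b) = x₂ (H.T a b)
  comm₃₅ : ∀ a b, rootCommutator (x₃ a) (x₅ b) = x₄ (H.T a b)
  comm₁₅ : ∀ a b, rootCommutator (x₁ a) (x₅ b) =
    x₂ (-H.T (H.sharp a) b) * x₃ (H.cross a b) * x₄ (H.T a (H.sharp b))
  comm₂₆ : ∀ t u, rootCommutator (x₂ t) (x₆ u) = x₄ (t * u)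
  comm₁₆ : ∀ a t, rootCommutator (x₁ a) (x₆ t) =
    x₂ (-(t * H.N a)) * x₃ (t • H.sharp a) * x₄ (t ^ 2 * H.N a) * x₅ (-(t • a))
  comm₁₂ : ∀ a t, rootCommutator (x₁ a) (x₂ t) = 1
  comm₁₄ : ∀ a t, rootCommutator (x₁ a) (x₄ t) = 1
  comm₂₃ : ∀ t a, rootCommutator (x₂ t) (x₃ a) = 1
  comm₂₄ : ∀ t u, rootCommutator (x₂ t) (x₄ u) = 1
  comm₂₅ : ∀ t a, rootCommutator (x₂ t) (x₅ a) = 1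
  comm₃₄ : ∀ a t, rootCommutator (x₃ a) (x₄ t) = 1
  comm₃₆ : ∀ a t, rootCommutator (x₃ a) (x₆ t) = 1
  comm₄₅ : ∀ t a, rootCommutator (x₄ t) (x₅ a) = 1
  comm₄₆ : ∀ t u, rootCommutator (x₄ t) (x₆ u) = 1
  comm₅₆ : ∀ a t, rootCommutator (x₅ a) (x₆ t) = 1

/-- The labels of the points: `(∞)` and the tuples of length at most five. -/
inductive PointLabel (F J : Type*) where
  | infty : PointLabel F J
  | one (t : F) : PointLabel F J
  | two (b : J) (u : F) : PointLabel F J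
  | three (t : F) (a : J) (t' : F) : PointLabel F J
  | four (b : J) (u : F) (b' : J) (u' : F) : PointLabel F J
  | five (t : F) (a : J) (t' : F) (a' : J) (t'' : F) : PointLabel F J

/-- The labels of the lines: `[∞]` and the tuples of length at most five. -/
inductive LineLabel (F J : Type*) where
  | infty : LineLabel F J
  | one (b : J) : LineLabel F J
  | two (t : F) (a : J) : LineLabel F J
  | three (b : J) (u : F) (b' : J) : LineLabel F J
  | four (t : F) (a : J) (t' : F) (a' : J) : LineLabel F J
  | five (b : J) (u : F) (b' : J) (u' : F) (b'' : J) : LineLabel F J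

/-- The links of the chain
`(t,a,t',a',t'') * [t,a,t',a'] * (t,a,t') * [t,a] * (t) * [∞] *`
`(∞) * [b] * (b,u) * [b,u,b'] * (b,u,b',u') * [b,u,b',u',b'']`. -/
inductive ChainIncident {F J : Type*} : PointLabel F J → LineLabel F J → Prop
  | five_four (t : F) (a : J) (t' : F) (a' : J) (t'' : F) :
      ChainIncident (.five t a t' a' t'') (.four t a t' a')
  | three_four (t : F) (a : J) (t' : F) (a' : J) :
      ChainIncident (.three t a t') (.four t a t' a')
  | three_two (t : F) (a : J) (t' : F) : ChainIncident (.three t a t') (.two t a)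
  | one_two (t : F) (a : J) : ChainIncident (.one t) (.two t a)
  | one_infty (t : F) : ChainIncident (.one t) .infty
  | infty_infty : ChainIncident .infty .infty
  | infty_one (b : J) : ChainIncident .infty (.one b)
  | two_one (b : J) (u : F) : ChainIncident (.two b u) (.one b)
  | two_three (b : J) (u : F) (b' : J) : ChainIncident (.two b u) (.three b u b')
  | four_three (b : J) (u : F) (b' : J) (u' : F) :
      ChainIncident (.four b u b' u') (.three b u b')
  | four_five (b : J) (u : F) (b' : J) (u' : F) (b'' : J) :
      ChainIncident (.four b u b' u') (.five b u b' u' b'')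

/-- The point label is a 5-tuple. -/
def PointLabel.IsGeneric {F J : Type*} : PointLabel F J → Prop
  | .five _ _ _ _ _ => True
  | _ => False

/-- The line label is a 5-tuple. -/
def LineLabel.IsGeneric {F J : Type*} : LineLabel F J → Prop
  | .five _ _ _ _ _ => True
  | _ => False

namespace HexagonLabelling

open PointLineGeometry

variable {P L F J : Type*} [Field F] [AddCommGroup J] [Module F J]
  {Γ : PointLineGeometry P L} {H : HexagonalSystem F J} (D : HexagonLabelling Γ H)

/-- `s₁` is a collineation that stabilises the base apartment and induces on it the reflection
fixing `p₀ = v 7` (and moving `L₀`). -/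
def RepresentsS₁ (s₁ : Γ.Collineation) : Prop := ∀ j, Collineation.act s₁ (D.v j) = D.v (14 - j)

/-- `s₆` is a collineation that stabilises the base apartment and induces on it the reflection
fixing `L₀ = v 6` (and moving `p₀`). -/
def RepresentsS₆ (s₆ : Γ.Collineation) : Prop := ∀ j, Collineation.act s₆ (D.v j) = D.v (12 - j)

/-- The point with a given label. The coset `g P₁` is the point `g p₀`, where `P₁` is the
stabiliser of `p₀`. -/
def point (s₁ s₆ : Γ.Collineation) : PointLabel F J → P
  | .infty => D.p₀
  | .one t => Collineation.onPoint (D.x₆ t * s₆) D.p₀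
  | .two b u => Collineation.onPoint (D.x₁ b * D.x₂ u * s₁ * s₆) D.p₀
  | .three t a t' => Collineation.onPoint (D.x₆ t * D.x₅ a * D.x₄ t' * s₆ * s₁ * s₆) D.p₀
  | .four b u b' u' =>
      Collineation.onPoint
        (D.x₁ b * D.x₂ u * D.x₃ b' * D.x₄ u' * s₁ * s₆ * s₁ * s₆) D.p₀
  | .five t a t' a' t'' =>
      Collineation.onPoint
        (D.x₆ t * D.x₅ a * D.x₄ t' * D.x₃ a' * D.x₂ t'' * s₆ * s₁ * s₆ * s₁ * s₆) D.p₀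

/-- The line with a given label. The coset `g P₆` is the line `g L₀`, where `P₆` is the
stabiliser of `L₀`. -/
def line (s₁ s₆ : Γ.Collineation) : LineLabel F J → L
  | .infty => D.L₀
  | .one b => Collineation.onLine (D.x₁ b * s₁) D.L₀
  | .two t a => Collineation.onLine (D.x₆ t * D.x₅ a * s₆ * s₁) D.L₀
  | .three b u b' => Collineation.onLine (D.x₁ b * D.x₂ u * D.x₃ b' * s₁ * s₆ * s₁) D.L₀
  | .four t a t' a' =>
      Collineation.onLine
        (D.x₆ t * D.x₅ a * D.x₄ t' * D.x₃ a' * s₆ * s₁ * s₆ * s₁) D.L₀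
  | .five b u b' u' b'' =>
      Collineation.onLine
        (D.x₁ b * D.x₂ u * D.x₃ b' * D.x₄ u' * D.x₅ b'' * s₁ * s₆ * s₁ * s₆ * s₁) D.L₀

end HexagonLabelling

/-! A non-backtracking path in the incidence graph that is shorter than twelve cannot close up.
Hence every element is the end of exactly one path of length between one and six that starts with
`L₀, p₀` or with `p₀, L₀`. Such paths are coordinatised one step at a time: the elements of `U_i`
fix `v_i, …, v_{i+6}`, and `U_i` acts simply transitively on the neighbours of `v_{i+6}` other than
`v_{i+5}`, and likewise on those of `v_i` other than `v_{i+1}`. Transitivity is the Moufang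
condition; freeness is the rigidity statement `eq_one_of_fixesNeighbours`. Thus `U₁, …, U₅`
parametrise the paths starting with `v₆, v₇`, and `U₆, …, U₂` those starting with `v₇, v₆`
(`Branch.exists_eq`, `Branch.smul_eq_smul_iff`). The words in `s₁, s₆` only carry `p₀` and `L₀`
around the apartment, so the ends of these paths are exactly the labelled elements.

Regularity also lists the neighbours of every labelled point (`MovesRegularly.adj_smul_iff`). Up to
4-tuples this gives the chain. A point labelled by a 5-tuple is `g v₁` with `g = x₆ x₅ x₄ x₃ x₂`;
its neighbours are `g v₂` and the lines `g x₁(b) v₀`. The commutator relations rewrite `g x₁(b)`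
with increasing indices (`reorder`), the final `x₆` fixes `v₀`, and the exponents are the first
system of equations. The second system follows by algebra in the hexagonal system. -/

namespace PointLineGeometry

variable {P L : Type*} {Γ : PointLineGeometry P L}

/-! ### Paths in the incidence graph and their uniqueness -/

theorem Adj.symm {x y : P ⊕ L} (h : Γ.Adj x y) : Γ.Adj y x := by
  cases x <;> cases y <;> exact h

theorem Adj.isLeft_eq {x y : P ⊕ L} (h : Γ.Adj x y) : y.isLeft = !x.isLeft := by
  cases x <;> cases y <;> first | rfl | exact h.elim

theorem Adj.ne {x y : P ⊕ L} (h : Γ.Adj x y) : x ≠ y := by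
  rintro rfl
  cases x <;> exact h

/-- Collineations act on the elements (points and lines) of the geometry. -/
instance elementAction : MulAction Γ.Collineation (P ⊕ L) where
  smul g x := Collineation.act g x
  one_smul x := by cases x <;> rfl
  mul_smul g h x := by cases x <;> rfl

theorem adj_smul_iff (g : Γ.Collineation) {x y : P ⊕ L} : Γ.Adj (g • x) (g • y) ↔ Γ.Adj x y := by
  cases x <;> cases y
  · exact Iff.rfl
  · exact g.2 _ _
  · exact g.2 _ _
  · exact Iff.rfl

theorem Collineation.eq_one {g : Γ.Collineation} (h : ∀ x : P ⊕ L, g • x = x) : g = 1 := by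
  apply Subtype.ext
  apply Prod.ext
  · ext p
    exact Sum.inl_injective (h (Sum.inl p))
  · ext l
    exact Sum.inr_injective (h (Sum.inr l))

variable (Γ) in
/-- The elements `γ 0, …, γ n` form a path without backtracking. -/
structure IsPath (n : ℕ) (γ : ℕ → P ⊕ L) : Prop where
  adj : ∀ i < n, Γ.Adj (γ i) (γ (i + 1))
  ne : ∀ i, i + 2 ≤ n → γ i ≠ γ (i + 2)

namespace IsPath

variable {n : ℕ} {γ : ℕ → P ⊕ L}

theorem mono (h : Γ.IsPath n γ) {m : ℕ} (hm : m ≤ n) : Γ.IsPath m γ :=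
  ⟨fun i hi => h.adj i (by omega), fun i hi => h.ne i (by omega)⟩

theorem shift (h : Γ.IsPath n γ) (k : ℕ) {m : ℕ} (hm : k + m ≤ n) :
    Γ.IsPath m fun i => γ (k + i) :=
  ⟨fun i hi => h.adj (k + i) (by omega), fun i hi => h.ne (k + i) (by omega)⟩

theorem reverse (h : Γ.IsPath n γ) : Γ.IsPath n fun i => γ (n - i) := by
  refine ⟨fun i hi => ?_, fun i hi => ?_⟩
  · have := (h.adj (n - (i + 1)) (by omega)).symm
    rwa [show n - (i + 1) + 1 = n - i by omega] at this
  · have := (h.ne (n - (i + 2)) (by omega)).symm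
    rwa [show n - (i + 2) + 2 = n - i by omega] at this

theorem smul (h : Γ.IsPath n γ) (g : Γ.Collineation) : Γ.IsPath n fun i => g • γ i :=
  ⟨fun i hi => (adj_smul_iff g).2 (h.adj i hi), fun i hi he => h.ne i hi (smul_left_cancel g he)⟩

theorem append {m : ℕ} {δ : ℕ → P ⊕ L} (h : Γ.IsPath m γ) (h' : Γ.IsPath n δ) (e : γ m = δ 0)
    (hne : 0 < m → 0 < n → γ (m - 1) ≠ δ 1) :
    Γ.IsPath (m + n) fun i => if i ≤ m then γ i else δ (i - m) := by
  refine ⟨fun i hi => ?_, fun i hi => ?_⟩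
  · rcases lt_trichotomy i m with hm | rfl | hm
    · simpa [hm.le, Nat.succ_le_of_lt hm] using h.adj i hm
    · simpa [e] using h'.adj 0 (by omega)
    · have := h'.adj (i - m) (by omega)
      rw [show i - m + 1 = i + 1 - m by omega] at this
      simpa [show ¬ i ≤ m by omega, show ¬ i + 1 ≤ m by omega] using this
  · rcases lt_trichotomy (i + 1) m with hm | rfl | hm
    · simpa [show i ≤ m by omega, show i + 2 ≤ m by omega] using h.ne i (by omega)
    · simpa [show i + 2 - (i + 1) = 1 by omega] using hne (by omega) (by omega)
    · have := h'.ne (i - m) (by omega)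
      rw [show i - m + 2 = i + 2 - m by omega] at this
      rcases Nat.lt_or_ge m i with hi' | hi'
      · simpa [show ¬ i ≤ m by omega, show ¬ i + 2 ≤ m by omega] using this
      · obtain rfl : i = m := by omega
        simpa [e] using this

theorem cons (h : Γ.IsPath n γ) {x : P ⊕ L} (hx : Γ.Adj x (γ 0)) (hne : 0 < n → x ≠ γ 1) :
    Γ.IsPath (n + 1) fun i => Nat.casesOn i x γ := by
  refine ⟨fun i hi => ?_, fun i hi => ?_⟩
  · cases i with
    | zero => exact hx
    | succ i => exact h.adj i (by omega)
  · cases i with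
    | zero => exact hne (by omega)
    | succ i => exact h.ne i (by omega)

theorem isLeft_eq (h : Γ.IsPath n γ) : ∀ i ≤ n, (γ i).isLeft = ((γ 0).isLeft ^^ decide (i % 2 = 1))
  | 0, _ => by simp
  | i + 1, hi => by
    rw [(h.adj i (by omega)).isLeft_eq, h.isLeft_eq i (by omega)]
    rcases Nat.mod_two_eq_zero_or_one i with hi | hi <;> simp [Nat.add_mod, hi]

theorem parity_eq (h : Γ.IsPath n γ) {m : ℕ} {δ : ℕ → P ⊕ L} (h' : Γ.IsPath m δ) (e₀ : γ 0 = δ 0)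
    (e : γ n = δ m) : n % 2 = m % 2 := by
  have h₁ := h.isLeft_eq n le_rfl
  have h₂ := h'.isLeft_eq m le_rfl
  rw [e, h₂, e₀] at h₁
  rcases Nat.mod_two_eq_zero_or_one n with hn | hn <;>
    rcases Nat.mod_two_eq_zero_or_one m with hm | hm <;>
    cases hd : (δ 0).isLeft <;> simp_all

end IsPath

namespace IsGeneralisedHexagon

variable (hΓ : Γ.IsGeneralisedHexagon)
include hΓ

/-- The incidence graph has no closed paths of length less than twelve. -/
theorem path_not_closed {n : ℕ} {γ : ℕ → P ⊕ L} (h : Γ.IsPath n γ) (h0 : 0 < n) (hn : n < 12) :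
    γ 0 ≠ γ n := by
  induction n using Nat.strong_induction_on generalizing γ with
  | _ n ih =>
  intro he
  -- The condition `j - i < n` excludes only the pair of ends; any other repetition cuts out a
  -- shorter closed path.
  by_cases hinj : ∃ i j, i < j ∧ j ≤ n ∧ j - i < n ∧ γ i = γ j
  · obtain ⟨i, j, hij, hj, hlt, e⟩ := hinj
    refine ih (j - i) hlt (h.shift i (m := j - i) (by omega)) (by omega) (by omega) ?_
    simpa [show i + (j - i) = j by omega] using e
  -- Without further repetitions the closed path is an ordinary `k`-gon: its length is even because
  -- the graph is bipartite, and `k = 1` would be backtracking.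
  · have hpar := h.parity_eq (m := 0) (δ := γ) (h.mono (by omega)) rfl he.symm
    obtain ⟨k, rfl⟩ : ∃ k, n = 2 * k := ⟨n / 2, by omega⟩
    have hk : k ≠ 1 := by
      rintro rfl
      exact h.ne 0 le_rfl he
    have : NeZero (2 * k) := ⟨by omega⟩
    refine hΓ.2.1 k (by omega) (by omega) (fun c => γ c.val) ⟨fun c d hcd => ?_, fun c => ?_⟩
    · by_contra hne
      have hc := ZMod.val_lt c
      have hd := ZMod.val_lt d
      have hv : c.val ≠ d.val := fun e => hne (ZMod.val_injective _ e)
      rcases Nat.lt_or_gt_of_ne hv with hlt | hlt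
      · exact hinj ⟨_, _, hlt, hd.le, by omega, hcd⟩
      · exact hinj ⟨_, _, hlt, hc.le, by omega, hcd.symm⟩
    · have hc := ZMod.val_lt c
      have hadj := h.adj c.val hc
      have : Fact (1 < 2 * k) := ⟨by omega⟩
      have hval : (c + 1).val = (c.val + 1) % (2 * k) := by
        rw [ZMod.val_add, ZMod.val_one]
      rcases Nat.lt_or_ge (c.val + 1) (2 * k) with hlt | hge
      · rw [Nat.mod_eq_of_lt hlt] at hval
        simpa only [hval] using hadj
      · have hc' : c.val + 1 = 2 * k := by omega
        rw [hc', Nat.mod_self] at hval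
        simp only [hval]
        rwa [hc', ← he] at hadj

/-- Two paths with common end points and total length less than twelve coincide. -/
theorem path_unique {m n : ℕ} {γ δ : ℕ → P ⊕ L} (h : Γ.IsPath m γ) (h' : Γ.IsPath n δ)
    (hmn : m + n < 12) (e₀ : γ 0 = δ 0) (e : γ m = δ n) : m = n ∧ ∀ i ≤ m, γ i = δ i := by
  induction m generalizing n with
  | zero =>
    rcases Nat.eq_zero_or_pos n with rfl | hn
    · exact ⟨rfl, fun i hi => by rwa [Nat.le_zero.1 hi]⟩
    · exact (hΓ.path_not_closed h' hn (by omega) (e₀ ▸ e)).elim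
  | succ m ih =>
    cases n with
    | zero => exact (hΓ.path_not_closed h (by omega) (by omega) (e₀.trans e.symm)).elim
    | succ n =>
      by_cases hl : γ m = δ n
      · obtain ⟨rfl, hi⟩ := ih (h.mono (by omega)) (h'.mono (by omega)) (by omega) hl
        refine ⟨rfl, fun i hi' => ?_⟩
        rcases Nat.lt_or_ge m i with hm | hm
        · rwa [show i = m + 1 by omega]
        · exact hi i hm
      -- If the penultimate elements differ, running along `γ` and back along `δ` gives a closed
      -- path without backtracking at the junction.
      · have hp := h.append h'.reverse (by simpa using e)
          (fun _ _ => by simpa using hl)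
        refine (hΓ.path_not_closed hp (by omega) (by omega) ?_).elim
        simpa [show ¬ m + 1 + (n + 1) ≤ m + 1 by omega] using e₀

end IsGeneralisedHexagon

theorem isPath_of_gon {v : ZMod (2 * 6) → P ⊕ L} (hv : Γ.IsOrdinaryGon 6 v) (i : ZMod (2 * 6))
    (n : ℕ) : Γ.IsPath n fun k => v (i + k) := by
  refine ⟨fun k _ => ?_, fun k _ he => ?_⟩
  · simpa [add_assoc] using hv.2 (i + k)
  · have := add_left_cancel (hv.1 he)
    rw [Nat.cast_add, left_eq_add] at this
    exact absurd this (by decide)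

theorem isPath_of_gon_neg {v : ZMod (2 * 6) → P ⊕ L} (hv : Γ.IsOrdinaryGon 6 v) (i : ZMod (2 * 6))
    (n : ℕ) : Γ.IsPath n fun k => v (i - k) := by
  refine ⟨fun k _ => ?_, fun k _ he => ?_⟩
  · have := (hv.2 (i - (k + 1 : ℕ))).symm
    rwa [show i - ((k + 1 : ℕ) : ZMod (2 * 6)) + 1 = i - k by push_cast; ring] at this
  · have := hv.1 he
    rw [sub_right_inj, Nat.cast_add, left_eq_add] at this
    exact absurd this (by decide)

variable (Γ) in
/-- Two elements at distance six. -/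
def Opposite (x y : P ⊕ L) : Prop := ∃ γ, Γ.IsPath 6 γ ∧ γ 0 = x ∧ γ 6 = y

theorem Opposite.symm {x y : P ⊕ L} (h : Γ.Opposite x y) : Γ.Opposite y x := by
  obtain ⟨γ, hγ, h0, h6⟩ := h
  exact ⟨_, hγ.reverse, h6, h0⟩

namespace IsGeneralisedHexagon

variable (hΓ : Γ.IsGeneralisedHexagon)
include hΓ

/-- Of the two arcs joining the elements in a common ordinary hexagon, one has length at most six.
-/
theorem exists_path (x y : P ⊕ L) : ∃ n ≤ 6, ∃ γ, Γ.IsPath n γ ∧ γ 0 = x ∧ γ n = y := by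
  obtain ⟨v, hv, ⟨i, rfl⟩, ⟨j, rfl⟩⟩ := hΓ.2.2 x y
  rcases Nat.le_total (j - i).val 6 with h | h
  · refine ⟨_, h, _, isPath_of_gon hv i _, by simp, ?_⟩
    simp
  · have hlt : (j - i).val < 12 := ZMod.val_lt (j - i)
    refine ⟨12 - (j - i).val, by omega, _, isPath_of_gon_neg hv i _, by simp, ?_⟩
    congr 1
    rw [Nat.cast_sub hlt.le, ZMod.natCast_zmod_val, show ((12 : ℕ) : ZMod (2 * 6)) = 0 from by decide]
    ring

/-- Every element incident with `x` lies on a path of length six from `x` to a given element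
opposite `x`. -/
theorem exists_path_through {x y z : P ⊕ L} (h : Γ.Opposite x y) (hz : Γ.Adj x z) :
    ∃ γ, Γ.IsPath 6 γ ∧ γ 0 = x ∧ γ 1 = z ∧ γ 6 = y := by
  obtain ⟨δ, hδ, rfl, rfl⟩ := h
  obtain ⟨n, hn, γ, hγ, h0, he⟩ := hΓ.exists_path z (δ 6)
  subst h0
  -- If the path from `z` returned through `x`, the rest of it would join `x` to `y` in at most five
  -- steps, against the uniqueness of paths.
  by_cases h1 : 0 < n ∧ δ 0 = γ 1
  · obtain ⟨hn0, h1⟩ := h1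
    have := hΓ.path_unique (hγ.shift 1 (m := n - 1) (by omega)) hδ (by omega) h1.symm
      (by simpa [show 1 + (n - 1) = n by omega] using he)
    omega
  · have hp := hγ.cons hz fun hn0 e => h1 ⟨hn0, e⟩
    have hpar := hp.parity_eq hδ rfl he
    obtain rfl : n = 5 := by
      by_contra hne
      have := hΓ.path_unique hp hδ (by omega) rfl he
      omega
    exact ⟨_, hp, rfl, rfl, he⟩

end IsGeneralisedHexagon

theorem exists_mem_ne_ne {α β : Type*} {s : Set α} (hs : 3 ≤ s.encard) {f : α → β}
    (hf : f.Injective) (y z : β) : ∃ a ∈ s, f a ≠ y ∧ f a ≠ z := by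
  by_contra! hcon
  have hsub : f '' s ⊆ {y, z} := by
    rintro _ ⟨a, ha, rfl⟩
    by_cases hy : f a = y
    · exact Or.inl hy
    · exact Or.inr (hcon a ha hy)
  have h2 := (Set.encard_le_encard hsub).trans
    ((Set.encard_insert_le {z} y).trans_eq (by rw [Set.encard_singleton]))
  rw [hf.encard_image] at h2
  exact absurd (hs.trans h2) (by decide)

theorem IsThick.exists_third (hΓ : Γ.IsThick) (x y z : P ⊕ L) :
    ∃ u, Γ.Adj x u ∧ u ≠ y ∧ u ≠ z := by
  cases x with
  | inl p =>
    obtain ⟨l, hl, h⟩ := exists_mem_ne_ne (hΓ.2 p) Sum.inr_injective y z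
    exact ⟨Sum.inr l, hl, h⟩
  | inr l =>
    obtain ⟨p, hp, h⟩ := exists_mem_ne_ne (hΓ.1 l) Sum.inl_injective y z
    exact ⟨Sum.inl p, hp, h⟩

/-- The collineation `g` fixes every element incident with `x`. -/
def FixesNeighbours (g : Γ.Collineation) (x : P ⊕ L) : Prop := ∀ y, Γ.Adj x y → g • y = y

/-! ### Rigidity of collineations -/

section Rigidity

variable (hΓ : Γ.IsGeneralisedHexagon) (hT : Γ.IsThick)
include hΓ

/-- An element `z` incident with `w` lies on a path of length six to `x`, whose last step comes from
a fixed neighbour of `x`. The path of length five from `w` to this neighbour is unique, hence fixed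
elementwise. -/
theorem FixesNeighbours.of_opposite {g : Γ.Collineation} {x w : P ⊕ L} (h : FixesNeighbours g x)
    (hw : g • w = w) (ho : Γ.Opposite x w) : FixesNeighbours g w := by
  intro z hz
  obtain ⟨γ, hγ, rfl, rfl, rfl⟩ := hΓ.exists_path_through ho.symm hz
  have h5 : g • γ 5 = γ 5 := h _ (hγ.adj 5 (by omega)).symm
  have := hΓ.path_unique (hγ.mono (m := 5) (by omega) |>.smul g) (hγ.mono (m := 5) (by omega))
    (by omega) hw h5
  exact this.2 1 (by omega)

include hT in
/-- If `g` fixes all elements incident with one of two incident elements `x` and `y`, and an element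
opposite `y`, then it also fixes all elements incident with any `z` incident with `y`. -/
theorem FixesNeighbours.propagate {g : Γ.Collineation} {x y z w : P ⊕ L} (hxy : Γ.Adj x y)
    (hx : FixesNeighbours g x) (hy : FixesNeighbours g y) (hw : g • w = w) (ho : Γ.Opposite y w)
    (hz : Γ.Adj y z) : FixesNeighbours g z ∧ ∃ w', g • w' = w' ∧ Γ.Opposite z w' := by
  -- Go from `y` through a third neighbour `u` towards `w`. The element `γ 5` is fixed and is
  -- opposite every neighbour of `y` except `u`, so it carries the fixing property from `x` to `z`.
  obtain ⟨u, hu, hux, huz⟩ := hT.exists_third y x z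
  obtain ⟨γ, hγ, rfl, rfl, rfl⟩ := hΓ.exists_path_through ho hu
  have hγ' := hγ.shift 1 (m := 5) (by omega)
  have hfix : g • γ 5 = γ 5 :=
    (hΓ.path_unique (hγ'.smul g) hγ' (by omega) (hy _ hu) hw).2 4 (by omega)
  have hop : ∀ {t}, Γ.Adj (γ 0) t → γ 1 ≠ t → Γ.Opposite t (γ 5) := fun {t} ht hne =>
    ⟨_, (hγ.mono (m := 5) (by omega)).cons ht.symm fun _ => hne.symm, rfl, rfl⟩
  have h5 := hx.of_opposite hΓ hfix (hop hxy.symm hux)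
  exact ⟨h5.of_opposite hΓ (hy _ hz) (hop hz huz).symm, _, hfix, hop hz huz⟩

include hT in
/-- A collineation that fixes all elements incident with one of two incident elements `x` and `y`,
and an element opposite `y`, is trivial. -/
theorem eq_one_of_fixesNeighbours {g : Γ.Collineation} {x y w : P ⊕ L} (hxy : Γ.Adj x y)
    (hx : FixesNeighbours g x) (hy : FixesNeighbours g y) (hw : g • w = w)
    (ho : Γ.Opposite y w) : g = 1 := by
  refine Collineation.eq_one fun e => ?_
  obtain ⟨n, -, γ, hγ, rfl, rfl⟩ := hΓ.exists_path y e
  -- All hypotheses of the propagation step are kept in the induction along a path from `y` to an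
  -- arbitrary element.
  have key : ∀ k ≤ n, g • γ k = γ k ∧ FixesNeighbours g (γ k) ∧
      (∃ x, Γ.Adj x (γ k) ∧ FixesNeighbours g x) ∧ ∃ w, g • w = w ∧ Γ.Opposite (γ k) w := by
    intro k
    induction k with
    | zero => exact fun _ => ⟨hx _ hxy, hy, ⟨x, hxy, hx⟩, w, hw, ho⟩
    | succ k ih =>
      intro hk
      obtain ⟨-, hy', ⟨x', hxy', hx'⟩, w', hw', ho'⟩ := ih (by omega)
      have hadj := hγ.adj k (by omega)
      obtain ⟨hz, hex⟩ := hx'.propagate hΓ hT hxy' hy' hw' ho' hadj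
      exact ⟨hy' _ hadj, hz, ⟨_, hadj, hy'⟩, hex⟩
  exact (key n le_rfl).1

end Rigidity

/-! ### Regular action of root groups -/

theorem fixesNeighbours_of_mem_rootGroup {γ : Fin 7 → P ⊕ L} {g : Γ.Collineation}
    (hg : g ∈ Γ.rootGroup γ) {i : Fin 7} (h0 : 0 < i) (h6 : i < 6) : FixesNeighbours g (γ i) :=
  hg i h0 h6

theorem IsRoot.rev {γ : Fin 7 → P ⊕ L} (h : Γ.IsRoot γ) : Γ.IsRoot fun k => γ k.rev := by
  refine ⟨h.1.comp Fin.rev_injective, fun i => ?_⟩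
  have := (h.2 i.rev).symm
  rwa [← Fin.rev_castSucc, ← Fin.rev_succ] at this

/-- Only the inner elements enter the definition of a root group. Hence the Moufang condition
applies at both ends of a root. -/
theorem rootGroup_rev (γ : Fin 7 → P ⊕ L) : Γ.rootGroup (fun k => γ k.rev) = Γ.rootGroup γ := by
  have key : ∀ γ : Fin 7 → P ⊕ L, Γ.rootGroup γ ≤ Γ.rootGroup (fun k => γ k.rev) :=
    fun γ g hg i h0 h6 => hg i.rev (by revert i; decide) (by revert i; decide)
  refine le_antisymm ?_ (key γ)
  simpa using key fun k => γ k.rev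

variable (Γ) in
/-- The family `y` of collineations fixes the incident elements `e` and `c`, and moves the element
`d` simply transitively over the elements other than `e` that are incident with `c`. -/
structure MovesRegularly {A : Type*} (y : A → Γ.Collineation) (e c d : P ⊕ L) : Prop where
  adj_left : Γ.Adj c e
  adj_right : Γ.Adj c d
  ne : d ≠ e
  fix_left : ∀ a, y a • e = e
  fix_centre : ∀ a, y a • c = c
  exists_smul_eq : ∀ z, Γ.Adj c z → z ≠ e → ∃ a, y a • d = z
  inj : ∀ a b, y a • d = y b • d → a = b

/-- The source of all incidences: applied to a labelled element `g • c`, it lists the labels of its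
neighbours. -/
theorem MovesRegularly.adj_smul_iff {A : Type*} {y : A → Γ.Collineation} {e c d : P ⊕ L}
    (h : Γ.MovesRegularly y e c d) (g : Γ.Collineation) (z : P ⊕ L) :
    Γ.Adj (g • c) z ↔ z = g • e ∨ ∃ a, z = (g * y a) • d := by
  constructor
  · intro hz
    by_cases he : z = g • e
    · exact Or.inl he
    · obtain ⟨a, ha⟩ := h.exists_smul_eq (g⁻¹ • z)
        (by rwa [← PointLineGeometry.adj_smul_iff g, smul_inv_smul])
        (fun hc => he (inv_smul_eq_iff.1 hc))
      exact Or.inr ⟨a, by rw [mul_smul, ha, smul_inv_smul]⟩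
  · rintro (rfl | ⟨a, rfl⟩)
    · exact (PointLineGeometry.adj_smul_iff g).2 h.adj_left
    · rw [mul_smul, PointLineGeometry.adj_smul_iff g]
      have := (PointLineGeometry.adj_smul_iff (y a)).2 h.adj_right
      rwa [h.fix_centre] at this

theorem IsMoufangHexagon.movesRegularly (hΓ : Γ.IsMoufangHexagon) {A : Type*} [AddGroup A]
    {y : A → Γ.Collineation} {γ : Fin 7 → P ⊕ L} (hγ : Γ.IsRoot γ)
    (hy : ParametrisesSubgroup y (Γ.rootGroup γ)) {d : P ⊕ L} (hd : Γ.Adj (γ 0) d)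
    (hne : d ≠ γ 1) : Γ.MovesRegularly y (γ 1) (γ 0) d := by
  have hmem : ∀ a, y a ∈ Γ.rootGroup γ := fun a => by
    have : y a ∈ Set.range y := ⟨a, rfl⟩
    rwa [hy.2.2] at this
  have h01 : Γ.Adj (γ 0) (γ 1) := hγ.2 0
  have h12 : Γ.Adj (γ 1) (γ 2) := hγ.2 1
  refine ⟨h01, hd, hne, fun a => hmem a 2 (by decide) (by decide) _ h12.symm,
    fun a => hmem a 1 (by decide) (by decide) _ h01.symm, fun z hz hz1 => ?_, fun a b hab => ?_⟩
  · obtain ⟨g, hg, e⟩ := hΓ.2.2 γ hγ d z hd hne hz hz1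
    have : g ∈ Set.range y := by rwa [hy.2.2]
    obtain ⟨a, rfl⟩ := this
    exact ⟨a, e⟩
  · apply hy.2.1
    have hg : (y b)⁻¹ * y a ∈ Γ.rootGroup γ := mul_mem (inv_mem (hmem b)) (hmem a)
    have h1 : (y b)⁻¹ * y a = 1 := by
      -- Rigidity for the incident elements `γ 4` and `γ 5`: the path `d, γ 0, …, γ 5` shows that
      -- `d` is opposite `γ 5`.
      refine eq_one_of_fixesNeighbours hΓ.1 hΓ.2.1 (hγ.2 4) (w := d)
        (fixesNeighbours_of_mem_rootGroup hg (by decide) (by decide))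
        (fixesNeighbours_of_mem_rootGroup hg (by decide) (by decide)) ?_ ?_
      · rw [mul_smul, hab, inv_smul_smul]
      · have hp : Γ.IsPath 5 fun i => γ (Fin.ofNat 7 i) := by
          refine ⟨fun i hi => ?_, fun i hi he => ?_⟩
          · interval_cases i
            exacts [hγ.2 0, hγ.2 1, hγ.2 2, hγ.2 3, hγ.2 4]
          · have := hγ.1 he
            have hi' : i ≤ 3 := by omega
            interval_cases i <;> exact absurd this (by decide)
        have := hp.cons hd.symm fun _ => hne
        exact Opposite.symm ⟨_, this, rfl, rfl⟩
    exact (inv_mul_eq_one.1 h1).symm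

theorem IsMoufangHexagon.movesRegularly_end (hΓ : Γ.IsMoufangHexagon) {A : Type*} [AddGroup A]
    {y : A → Γ.Collineation} {γ : Fin 7 → P ⊕ L} (hγ : Γ.IsRoot γ)
    (hy : ParametrisesSubgroup y (Γ.rootGroup γ)) {d : P ⊕ L} (hd : Γ.Adj (γ 6) d)
    (hne : d ≠ γ 5) : Γ.MovesRegularly y (γ 5) (γ 6) d :=
  hΓ.movesRegularly hγ.rev (by rwa [rootGroup_rev]) hd hne

theorem isRoot_of_gon {v : ZMod (2 * 6) → P ⊕ L} (hv : Γ.IsOrdinaryGon 6 v) (i : ZMod (2 * 6)) :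
    Γ.IsRoot fun k => v (i + (k : ℕ)) := by
  refine ⟨fun k l e => ?_, fun k => ?_⟩
  · have := add_left_cancel (hv.1 e)
    clear e
    revert k l
    decide
  · simpa [add_assoc] using hv.2 (i + (k : ℕ))

/-! ### Reflections of an apartment -/

/-- Every residue modulo twelve is `k` or `-k` with `k ≤ 6`, so it suffices to treat the two arcs
from `v 0` to `v 6`. -/
theorem eq_of_gon_sub {v : ZMod (2 * 6) → P ⊕ L} (s : Γ.Collineation)
    (h : ∀ k : ℕ, k ≤ 6 → s • v k = v (-k) ∧ s • v (-k) = v k) (j : ZMod (2 * 6)) :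
    s • v j = v (-j) := by
  have hlt : j.val < 12 := ZMod.val_lt j
  rcases Nat.le_total j.val 6 with hj | hj
  · simpa using (h _ hj).1
  · have := (h (12 - j.val) (by omega)).2
    rw [Nat.cast_sub hlt.le, ZMod.natCast_zmod_val,
      show ((12 : ℕ) : ZMod (2 * 6)) = 0 from by decide] at this
    simpa using this

/-- The reflections of an ordinary hexagon are induced by collineations. -/
theorem IsMoufangHexagon.exists_reflection (hΓ : Γ.IsMoufangHexagon) {v : ZMod (2 * 6) → P ⊕ L}
    (hv : Γ.IsOrdinaryGon 6 v) (i : ZMod (2 * 6)) :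
    ∃ s : Γ.Collineation, ∀ j, s • v j = v (i + i - j) := by
  wlog hi : i = 0 generalizing v i
  · obtain ⟨s, hs⟩ := this (v := fun j => v (i + j))
      ⟨hv.1.comp (add_right_injective i), fun j => by simpa [add_assoc] using hv.2 (i + j)⟩ 0 rfl
    refine ⟨s, fun j => ?_⟩
    have := hs (j - i)
    simp only [add_sub_cancel] at this
    rw [this]
    congr 1
    ring
  subst hi
  have hr₀ : Γ.IsRoot fun k => v (0 + (k : ℕ)) := isRoot_of_gon hv 0
  have hr₆ : Γ.IsRoot fun k => v (6 + (k : ℕ)) := isRoot_of_gon hv 6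
  have hadj : Γ.Adj (v 0) (v 1) := hv.2 0
  have hadj' : Γ.Adj (v 0) (v (-1)) := by simpa using (hv.2 (-1)).symm
  have hne : v (-1) ≠ v 1 := fun e => absurd (hv.1 e) (by decide)
  have hfix : ∀ (i : ZMod (2 * 6)) {g}, g ∈ Γ.rootGroup (fun k => v (i + (k : ℕ))) →
      g • v i = v i ∧ g • v (i + 6) = v (i + 6) ∧ g • v (i + 5) = v (i + 5) := by
    intro i g hg
    have hr := isRoot_of_gon hv i
    have h1 : g • v (i + 0) = v (i + 0) := hg 1 (by decide) (by decide) _ (hr.2 0).symm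
    exact ⟨by rwa [add_zero] at h1, hg 5 (by decide) (by decide) _ (hr.2 5),
      hg 4 (by decide) (by decide) _ (hr.2 4)⟩
  -- The reflection is `h' * g * h`, with `g` in a root group and `h, h'` in the opposite one; all
  -- three fix `v 0` and `v 6`. They are chosen so that `v 1 ↦ g⁻¹ • v (-1) ↦ v (-1) ↦ v (-1)` and
  -- `v (-1) ↦ v (-1) ↦ y ↦ v 1`.
  obtain ⟨y, hy, hy1, hy'⟩ := hΓ.2.1.exists_third (v 0) (v 1) (v (-1))
  obtain ⟨g, hg, hgy⟩ := hΓ.2.2 _ hr₀ (v (-1)) y hadj' hne hy hy1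
  obtain ⟨hg0, hg6, -⟩ := hfix 0 hg
  have move : ∀ z z', Γ.Adj (v 0) z → z ≠ v (-1) → Γ.Adj (v 0) z' → z' ≠ v (-1) →
      ∃ h ∈ Γ.rootGroup (fun k => v (6 + (k : ℕ))), h • z = z' := by
    intro z z' h1 h2 h3 h4
    obtain ⟨h, hh, e⟩ := hΓ.2.2 _ hr₆.rev z z' h1 h2 h3 h4
    exact ⟨h, (rootGroup_rev fun k => v (6 + (k : ℕ))).le hh, e⟩
  obtain ⟨h', hh', e'⟩ := move y (v 1) hy hy' hadj hne.symm
  obtain ⟨h, hh, e⟩ := move (v 1) (g⁻¹ • v (-1)) hadj hne.symm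
    (by rwa [← adj_smul_iff g, smul_inv_smul, hg0])
    (fun e => hy' (by rw [inv_smul_eq_iff] at e; exact (hgy.symm.trans e.symm)))
  obtain ⟨hh6, hh0, hh1⟩ := hfix 6 hh
  obtain ⟨hh6', hh0', hh1'⟩ := hfix 6 hh'
  change h • v 0 = v 0 at hh0
  change h' • v 0 = v 0 at hh0'
  change h • v (-1) = v (-1) at hh1
  change h' • v (-1) = v (-1) at hh1'
  change g • v 6 = v 6 at hg6
  change g • v (-1) = y at hgy
  have s0 : (h' * g * h) • v 0 = v 0 := by rw [mul_smul, mul_smul, hh0, hg0, hh0']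
  have s6 : (h' * g * h) • v 6 = v 6 := by rw [mul_smul, mul_smul, hh6, hg6, hh6']
  have s1 : (h' * g * h) • v 1 = v (-1) := by rw [mul_smul, mul_smul, e, smul_inv_smul, hh1']
  have s1' : (h' * g * h) • v (-1) = v 1 := by rw [mul_smul, mul_smul, hh1, hgy, e']
  refine ⟨h' * g * h, fun j => ?_⟩
  rw [add_zero, zero_sub]
  refine eq_of_gon_sub _ (fun k hk => ?_) j
  rcases Nat.eq_zero_or_pos k with rfl | hk0
  · simpa using s0
  -- Since `v 1` and `v (-1)` are interchanged and `v 6` is fixed, uniqueness of paths of length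
  -- five interchanges the two arcs.
  have hp := (isPath_of_gon hv 0 6).shift 1 (m := 5) (by omega)
  have hp' := (isPath_of_gon_neg hv 0 6).shift 1 (m := 5) (by omega)
  have h₁ := (hΓ.1.path_unique (hp.smul (h' * g * h)) hp' (by omega) s1 s6).2 (k - 1) (by omega)
  have h₂ := (hΓ.1.path_unique (hp'.smul (h' * g * h)) hp (by omega) s1' s6).2 (k - 1) (by omega)
  simp only [show 1 + (k - 1) = k by omega, zero_add, zero_sub] at h₁ h₂
  exact ⟨h₁, h₂⟩

end PointLineGeometry

/-! ### Collecting products of root group elements -/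

theorem mul_eq_of_rootCommutator {G : Type*} [Group G] {g h k : G} (e : rootCommutator g h = k) :
    h * g = g * h * k⁻¹ := by
  subst e
  simp only [rootCommutator]
  group

theorem mul_comm_of_rootCommutator {G : Type*} [Group G] {g h : G} (e : rootCommutator g h = 1) :
    h * g = g * h := by
  simpa using mul_eq_of_rootCommutator e

/-- Lets `simp` use a rule for two factors inside a right-associated product. -/
theorem mul_left_of_mul_eq {G : Type*} [Group G] {g h k : G} (e : g * h = k) (z : G) :
    g * (h * z) = k * z := by
  rw [← e, mul_assoc]

namespace ParametrisesSubgroup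

variable {A G : Type*} [AddGroup A] [Group G] {x : A → G} {U : Subgroup G}

theorem map_zero (h : ParametrisesSubgroup x U) : x 0 = 1 := by
  simpa using h.1 0 0

theorem inv (h : ParametrisesSubgroup x U) (a : A) : (x a)⁻¹ = x (-a) := by
  rw [inv_eq_iff_mul_eq_one, ← h.1, add_neg_cancel, h.map_zero]

end ParametrisesSubgroup

namespace HexagonalSystem

variable {F J : Type*} [Field F] [AddCommGroup J] [Module F J] (H : HexagonalSystem F J)

/-- Compare `(2a)^# = 4 a^#` with the addition rule for `#`. -/
theorem cross_self (a : J) : H.cross a a = (2 : F) • H.sharp a := by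
  have h := H.sharp_add a a
  rw [← two_smul F a, H.sharp_smul] at h
  have : H.cross a a = (2 : F) ^ 2 • H.sharp a - H.sharp a - H.sharp a := by rw [h]; abel
  rw [this]
  module

theorem T_cross_self (a b : J) : H.T (H.cross a b) a = 2 * H.T (H.sharp a) b := by
  rw [H.T_symm, H.T_cross, H.cross_self, map_smul, LinearMap.smul_apply, smul_eq_mul]

theorem T_cross_self' (a b : J) : H.T (H.cross b a) a = 2 * H.T (H.sharp a) b := by
  rw [H.cross_symm, H.T_cross_self]

end HexagonalSystem

namespace HexagonLabelling

variable {P L F J : Type*} [Field F] [AddCommGroup J] [Module F J]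
  {Γ : PointLineGeometry P L} {H : HexagonalSystem F J} (D : HexagonLabelling Γ H)

theorem x₃_mul_x₁ (a b : J) : D.x₃ a * D.x₁ b = D.x₁ b * (D.x₂ (-H.T b a) * D.x₃ a) := by
  rw [mul_eq_of_rootCommutator (D.comm₁₃ b a), D.param₂.inv, mul_assoc,
    ← mul_comm_of_rootCommutator (D.comm₂₃ _ _)]

theorem x₅_mul_x₃ (a b : J) : D.x₅ a * D.x₃ b = D.x₃ b * (D.x₄ (-H.T b a) * D.x₅ a) := by
  rw [mul_eq_of_rootCommutator (D.comm₃₅ b a), D.param₄.inv, mul_assoc,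
    ← mul_comm_of_rootCommutator (D.comm₄₅ _ _)]

theorem x₆_mul_x₂ (t u : F) : D.x₆ t * D.x₂ u = D.x₂ u * (D.x₄ (-(u * t)) * D.x₆ t) := by
  rw [mul_eq_of_rootCommutator (D.comm₂₆ u t), D.param₄.inv, mul_assoc,
    ← mul_comm_of_rootCommutator (D.comm₄₆ _ _)]

/-- Inverting the commutator gives the exponent `-T(b, a^#)` in `x₄`. Moving `x₅` past `x₃` adds
`T(b × a, a) = 2 T(a^#, b)`, which reverses the sign. -/
theorem x₅_mul_x₁ (a b : J) : D.x₅ a * D.x₁ b = D.x₁ b *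
    (D.x₂ (H.T (H.sharp b) a) * (D.x₃ (-H.cross b a) * (D.x₄ (H.T (H.sharp a) b) * D.x₅ a))) := by
  rw [mul_eq_of_rootCommutator (D.comm₁₅ b a)]
  simp only [mul_inv_rev, D.param₂.inv, D.param₃.inv, D.param₄.inv, neg_neg, mul_assoc]
  congr 1
  have h45 := fun t a => mul_comm_of_rootCommutator (D.comm₄₅ t a)
  have h34 := fun a t => mul_comm_of_rootCommutator (D.comm₃₄ a t)
  have h24 := fun t u => mul_comm_of_rootCommutator (D.comm₂₄ t u)
  have h23 := fun t a => mul_comm_of_rootCommutator (D.comm₂₃ t a)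
  have h25 := fun t a => mul_comm_of_rootCommutator (D.comm₂₅ t a)
  simp only [h45, h34, h23, mul_left_of_mul_eq (h24 _ _), mul_left_of_mul_eq (h25 _ _),
    mul_left_of_mul_eq (D.x₅_mul_x₃ _ _), mul_assoc, mul_left_of_mul_eq (D.param₄.1 _ _).symm]
  congr 4
  simp [H.T_cross_self', H.T_symm b]
  ring

/-- The exponent of `x₄` collects `-t² N(b)` from the inverse commutator, `-t² N(b)` from moving
`x₆` past `x₂`, and `t² T(b^#, b) = 3 t² N(b)` from moving `x₅` past `x₃`. -/
theorem x₆_mul_x₁ (t : F) (b : J) : D.x₆ t * D.x₁ b = D.x₁ b * (D.x₂ (t * H.N b) *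
    (D.x₃ (-(t • H.sharp b)) * (D.x₄ (t ^ 2 * H.N b) * (D.x₅ (t • b) * D.x₆ t)))) := by
  rw [mul_eq_of_rootCommutator (D.comm₁₆ b t)]
  simp only [mul_inv_rev, D.param₂.inv, D.param₃.inv, D.param₄.inv, D.param₅.inv, neg_neg,
    mul_assoc]
  congr 1
  have h45 := fun t a => mul_comm_of_rootCommutator (D.comm₄₅ t a)
  have h34 := fun a t => mul_comm_of_rootCommutator (D.comm₃₄ a t)
  have h24 := fun t u => mul_comm_of_rootCommutator (D.comm₂₄ t u)
  have h23 := fun t a => mul_comm_of_rootCommutator (D.comm₂₃ t a)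
  have h25 := fun t a => mul_comm_of_rootCommutator (D.comm₂₅ t a)
  have h36 := fun a t => mul_comm_of_rootCommutator (D.comm₃₆ a t)
  have h46 := fun t u => mul_comm_of_rootCommutator (D.comm₄₆ t u)
  have h56 := fun a t => mul_comm_of_rootCommutator (D.comm₅₆ a t)
  simp only [h45, h34, h23, h56, mul_left_of_mul_eq (h36 _ _), mul_left_of_mul_eq (h46 _ _),
    mul_left_of_mul_eq (h34 _ _), mul_left_of_mul_eq (h24 _ _), mul_left_of_mul_eq (h25 _ _),
    mul_left_of_mul_eq (D.x₅_mul_x₃ _ _), mul_left_of_mul_eq (D.x₆_mul_x₂ _ _), mul_assoc,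
    mul_left_of_mul_eq (D.param₄.1 _ _).symm]
  congr 4
  simp [H.T_symm (H.sharp b), H.T_sharp]
  ring

/-- Reordering of a product of elements of the six positive root groups. -/
theorem reorder (t t' t'' : F) (a a' b : J) :
    D.x₆ t * D.x₅ a * D.x₄ t' * D.x₃ a' * D.x₂ t'' * D.x₁ b =
      D.x₁ b * D.x₂ (t'' + t * H.N b - H.T a' b + H.T a (H.sharp b)) *
        D.x₃ (a' - H.cross a b - t • H.sharp b) *
        D.x₄ (t' + t ^ 2 * H.N b - t * t'' + t * H.T a (H.sharp b) + H.T (H.sharp a) b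
          - H.T a a') * D.x₅ (a + t • b) * D.x₆ t := by
  have h12 := fun a t => mul_comm_of_rootCommutator (D.comm₁₂ a t)
  have h14 := fun a t => mul_comm_of_rootCommutator (D.comm₁₄ a t)
  have h45 := fun t a => mul_comm_of_rootCommutator (D.comm₄₅ t a)
  have h34 := fun a t => mul_comm_of_rootCommutator (D.comm₃₄ a t)
  have h24 := fun t u => mul_comm_of_rootCommutator (D.comm₂₄ t u)
  have h23 := fun t a => mul_comm_of_rootCommutator (D.comm₂₃ t a)
  have h25 := fun t a => mul_comm_of_rootCommutator (D.comm₂₅ t a)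
  have h36 := fun a t => mul_comm_of_rootCommutator (D.comm₃₆ a t)
  have h46 := fun t u => mul_comm_of_rootCommutator (D.comm₄₆ t u)
  have h56 := fun a t => mul_comm_of_rootCommutator (D.comm₅₆ a t)
  simp only [mul_assoc]
  -- This pass brings `x₁ b` to the front; the next one sorts the other factors by index and merges
  -- equal indices.
  simp only [h12, mul_left_of_mul_eq (h14 _ _), mul_left_of_mul_eq (D.x₃_mul_x₁ _ _),
    mul_left_of_mul_eq (D.x₅_mul_x₁ _ _), mul_left_of_mul_eq (D.x₆_mul_x₁ _ _),
    mul_assoc]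
  simp only [h45, h34, h23, h56, mul_left_of_mul_eq (h45 _ _),
    mul_left_of_mul_eq (h36 _ _), mul_left_of_mul_eq (h46 _ _), mul_left_of_mul_eq (h34 _ _),
    mul_left_of_mul_eq (h24 _ _), mul_left_of_mul_eq (h23 _ _), mul_left_of_mul_eq (h25 _ _),
    mul_left_of_mul_eq (D.x₅_mul_x₃ _ _), mul_left_of_mul_eq (D.x₆_mul_x₂ _ _), mul_assoc,
    mul_left_of_mul_eq (D.param₂.1 _ _).symm, mul_left_of_mul_eq (D.param₃.1 _ _).symm,
    mul_left_of_mul_eq (D.param₄.1 _ _).symm, mul_left_of_mul_eq (D.param₅.1 _ _).symm]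
  congr 1
  congr 1
  · congr 1
    rw [H.T_symm b, H.T_symm a]
    ring
  congr 1
  · congr 1
    rw [H.cross_symm b]
    abel
  congr 1
  · congr 1
    simp [H.T_cross_self', H.T_symm b, H.T_symm (H.sharp b), H.T_symm a' a,
      H.cross_symm b a]
    ring
  · congr 2
    abel

end HexagonLabelling

/-- The two systems of equations describing the incidence of generic points and lines are
equivalent. -/
theorem HexagonalSystem.system_iff {F J : Type*} [Field F] [AddCommGroup J] [Module F J]
    (H : HexagonalSystem F J) (t t' t'' u u' : F) (a a' b b' b'' : J) :
    (u = t'' + t * H.N b - H.T a' b + H.T a (H.sharp b) ∧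
      b' = a' - H.cross a b - t • H.sharp b ∧
      u' = t' + t ^ 2 * H.N b - t * t'' + t * H.T a (H.sharp b) + H.T (H.sharp a) b
        - H.T a a' ∧
      b'' = a + t • b) ↔
    (a = b'' - t • b ∧
      t' = u' + t ^ 2 * H.N b + u * t - t * H.T b'' (H.sharp b) + H.T b' b''
        + H.T (H.sharp b'') b ∧
      a' = b' + H.cross b b'' - t • H.sharp b ∧
      t'' = u - t * H.N b + H.T b b' + H.T b'' (H.sharp b)) := by
  have hb : H.T (H.sharp b) b = 3 * H.N b := by rw [H.T_symm, H.T_sharp]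
  -- Both directions substitute and expand. Beyond linearity, only the polarisation of `#`, the
  -- rules for `b × b` and `T(a × b, a)`, the symmetries and `T(b^#, b) = 3 N(b)` enter.
  constructor
  · rintro ⟨rfl, rfl, rfl, rfl⟩
    refine ⟨by abel, ?_, ?_, ?_⟩
    · simp [H.sharp_add, H.sharp_smul, H.T_cross_self, H.T_cross_self', hb, H.T_sharp,
        H.T_symm (H.sharp b) a, H.T_symm a' a]
      ring
    · simp [H.cross_self, H.cross_symm b a]
      module
    · simp [H.T_cross_self', hb, H.T_sharp, H.T_symm b, H.T_symm (H.sharp b) a]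
      ring
  · rintro ⟨rfl, rfl, rfl, rfl⟩
    have hs : H.sharp (b'' - t • b) = H.sharp b'' - t • H.cross b'' b + t ^ 2 • H.sharp b := by
      rw [sub_eq_add_neg, ← neg_smul, H.sharp_add, H.sharp_smul, map_smul]
      module
    refine ⟨?_, ?_, ?_, by abel⟩
    · simp [H.T_cross_self, hb, H.T_sharp, H.T_symm b, H.T_symm (H.sharp b) b'']
      ring
    · simp [H.cross_self, H.cross_symm b b'']
      module
    · simp [hs, H.T_cross_self, H.T_cross_self', hb, H.T_sharp,
        H.T_symm b, H.T_symm (H.sharp b) b'', H.T_symm b'' b', H.cross_symm b b'',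
        H.T_symm b'' (H.cross _ _)]
      ring

/-! ### Coordinates for paths starting at a chamber -/

namespace PointLineGeometry

variable {P L : Type*} {Γ : PointLineGeometry P L}

/-- A path `w 0, …, w 6` together with five families of collineations that parametrise all paths of
length six with the same first two elements. -/
structure Branch {A₁ A₂ A₃ A₄ A₅ : Type*} (Γ : PointLineGeometry P L) (w : ℕ → P ⊕ L)
    (y₁ : A₁ → Γ.Collineation) (y₂ : A₂ → Γ.Collineation) (y₃ : A₃ → Γ.Collineation)
    (y₄ : A₄ → Γ.Collineation) (y₅ : A₅ → Γ.Collineation) : Prop where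
  path : Γ.IsPath 6 w
  fix₁ : ∀ a, ∀ j ≤ 1, y₁ a • w j = w j
  fix₂ : ∀ a, ∀ j ≤ 2, y₂ a • w j = w j
  fix₃ : ∀ a, ∀ j ≤ 3, y₃ a • w j = w j
  fix₄ : ∀ a, ∀ j ≤ 4, y₄ a • w j = w j
  fix₅ : ∀ a, ∀ j ≤ 5, y₅ a • w j = w j
  reg₁ : Γ.MovesRegularly y₁ (w 0) (w 1) (w 2)
  reg₂ : Γ.MovesRegularly y₂ (w 1) (w 2) (w 3)
  reg₃ : Γ.MovesRegularly y₃ (w 2) (w 3) (w 4)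
  reg₄ : Γ.MovesRegularly y₄ (w 3) (w 4) (w 5)
  reg₅ : Γ.MovesRegularly y₅ (w 4) (w 5) (w 6)

/-- The next element of `δ` is a neighbour of `g • w (k + 1)` other than `g • w k`, so regularity
supplies `a`. The agreement already reached survives because `y a` fixes the earlier `w j`. -/
theorem MovesRegularly.extend {A : Type*} [Nonempty A] {y : A → Γ.Collineation} {n k : ℕ}
    {w δ : ℕ → P ⊕ L} (h : Γ.MovesRegularly y (w k) (w (k + 1)) (w (k + 2)))
    (hfix : ∀ a, ∀ j ≤ k + 1, y a • w j = w j) (hδ : Γ.IsPath n δ) {g : Γ.Collineation}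
    (hg : ∀ i ≤ k + 1, i ≤ n → δ i = g • w i) :
    ∃ a, ∀ i ≤ k + 2, i ≤ n → δ i = (g * y a) • w i := by
  have key : ∃ a, k + 2 ≤ n → δ (k + 2) = (g * y a) • w (k + 2) := by
    by_cases hn : k + 2 ≤ n
    · have h1 := hδ.adj (k + 1) (by omega)
      rw [hg (k + 1) le_rfl (by omega), h.adj_smul_iff] at h1
      rcases h1 with h1 | ⟨a, ha⟩
      · exact (hδ.ne k hn ((hg k (by omega) (by omega)).trans h1.symm)).elim
      · exact ⟨a, fun _ => ha⟩
    -- The path has already ended, so this coordinate has no effect.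
    · exact ⟨Classical.arbitrary A, fun h => absurd h hn⟩
  obtain ⟨a, ha⟩ := key
  refine ⟨a, fun i hi hin => ?_⟩
  rcases Nat.lt_or_ge (k + 1) i with h2 | h2
  · obtain rfl : i = k + 2 := by omega
    exact ha hin
  · rw [mul_smul, hfix a i h2, hg i h2 hin]

theorem MovesRegularly.injective_mul {A : Type*} {y : A → Γ.Collineation} {e c d : P ⊕ L}
    (h : Γ.MovesRegularly y e c d) {g : Γ.Collineation} {a b : A}
    (hab : (g * y a) • d = (g * y b) • d) : a = b := by
  rw [mul_smul, mul_smul] at hab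
  exact h.inj a b (smul_left_cancel g hab)

namespace Branch

variable {A₁ A₂ A₃ A₄ A₅ : Type*} {w : ℕ → P ⊕ L} {y₁ : A₁ → Γ.Collineation}
  {y₂ : A₂ → Γ.Collineation} {y₃ : A₃ → Γ.Collineation} {y₄ : A₄ → Γ.Collineation}
  {y₅ : A₅ → Γ.Collineation} (B : Branch Γ w y₁ y₂ y₃ y₄ y₅)
include B

theorem exists_eq [Nonempty A₁] [Nonempty A₂] [Nonempty A₃] [Nonempty A₄] [Nonempty A₅] {n : ℕ}
    {δ : ℕ → P ⊕ L} (hδ : Γ.IsPath n δ) (hn : n ≤ 6) (e₀ : δ 0 = w 0) (e₁ : δ 1 = w 1) :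
    ∃ a₁ a₂ a₃ a₄ a₅, δ n = (y₁ a₁ * y₂ a₂ * y₃ a₃ * y₄ a₄ * y₅ a₅) • w n := by
  have h₀ : ∀ i ≤ 1, i ≤ n → δ i = (1 : Γ.Collineation) • w i := by
    intro i hi _
    rw [one_smul]
    interval_cases i <;> assumption
  obtain ⟨a₁, h₁⟩ := B.reg₁.extend B.fix₁ hδ h₀
  obtain ⟨a₂, h₂⟩ := B.reg₂.extend B.fix₂ hδ h₁
  obtain ⟨a₃, h₃⟩ := B.reg₃.extend B.fix₃ hδ h₂
  obtain ⟨a₄, h₄⟩ := B.reg₄.extend B.fix₄ hδ h₃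
  obtain ⟨a₅, h₅⟩ := B.reg₅.extend B.fix₅ hδ h₄
  exact ⟨a₁, a₂, a₃, a₄, a₅, by simpa using h₅ n hn le_rfl⟩

theorem smul_of_le_one (a₁ : A₁) (a₂ : A₂) (a₃ : A₃) (a₄ : A₄) (a₅ : A₅) {j : ℕ} (hj : j ≤ 1) :
    (y₁ a₁ * y₂ a₂ * y₃ a₃ * y₄ a₄ * y₅ a₅) • w j = w j := by
  simp only [mul_smul]
  rw [B.fix₅ _ j (by omega), B.fix₄ _ j (by omega), B.fix₃ _ j (by omega), B.fix₂ _ j (by omega),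
    B.fix₁ _ j (by omega)]

theorem smul_eq_smul_iff (hΓ : Γ.IsGeneralisedHexagon) {a₁ b₁ : A₁} {a₂ b₂ : A₂} {a₃ b₃ : A₃}
    {a₄ b₄ : A₄} {a₅ b₅ : A₅} {k l : ℕ} (hk : 1 ≤ k) (hk6 : k ≤ 6) (hl : 1 ≤ l) (hl6 : l ≤ 6) :
    (y₁ a₁ * y₂ a₂ * y₃ a₃ * y₄ a₄ * y₅ a₅) • w k = (y₁ b₁ * y₂ b₂ * y₃ b₃ * y₄ b₄ * y₅ b₅) • w l ↔
      k = l ∧ (2 ≤ k → a₁ = b₁) ∧ (3 ≤ k → a₂ = b₂) ∧ (4 ≤ k → a₃ = b₃) ∧ (5 ≤ k → a₄ = b₄) ∧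
        (6 ≤ k → a₅ = b₅) := by
  have e₂ : ∀ (g : Γ.Collineation) a₂ a₃ a₄ a₅,
      (g * y₂ a₂ * y₃ a₃ * y₄ a₄ * y₅ a₅) • w 2 = g • w 2 := fun g a₂ a₃ a₄ a₅ => by
    simp only [mul_smul]
    rw [B.fix₅ _ 2 (by omega), B.fix₄ _ 2 (by omega), B.fix₃ _ 2 (by omega), B.fix₂ _ 2 (by omega)]
  have e₃ : ∀ (g : Γ.Collineation) a₃ a₄ a₅, (g * y₃ a₃ * y₄ a₄ * y₅ a₅) • w 3 = g • w 3 :=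
    fun g a₃ a₄ a₅ => by
      simp only [mul_smul]
      rw [B.fix₅ _ 3 (by omega), B.fix₄ _ 3 (by omega), B.fix₃ _ 3 (by omega)]
  have e₄ : ∀ (g : Γ.Collineation) a₄ a₅, (g * y₄ a₄ * y₅ a₅) • w 4 = g • w 4 := fun g a₄ a₅ => by
    simp only [mul_smul]
    rw [B.fix₅ _ 4 (by omega), B.fix₄ _ 4 (by omega)]
  have e₅ : ∀ (g : Γ.Collineation) a₅, (g * y₅ a₅) • w 5 = g • w 5 := fun g a₅ => by
    simp only [mul_smul]
    rw [B.fix₅ _ 5 (by omega)]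
  constructor
  · intro h
    -- Dropping the common element `w 0` matters: the total length is then at most ten, below the
    -- bound twelve, and the two paths coincide. Their successive elements give the coordinates one
    -- by one.
    have hp := (B.path.mono hk6).smul (y₁ a₁ * y₂ a₂ * y₃ a₃ * y₄ a₄ * y₅ a₅) |>.shift 1
      (m := k - 1) (by omega)
    have hq := (B.path.mono hl6).smul (y₁ b₁ * y₂ b₂ * y₃ b₃ * y₄ b₄ * y₅ b₅) |>.shift 1
      (m := l - 1) (by omega)
    obtain ⟨hkl, hu⟩ := hΓ.path_unique hp hq (by omega)
      ((B.smul_of_le_one _ _ _ _ _ le_rfl).trans (B.smul_of_le_one _ _ _ _ _ le_rfl).symm)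
      (by simpa only [show 1 + (k - 1) = k by omega, show 1 + (l - 1) = l by omega] using h)
    have h₁ : 2 ≤ k → a₁ = b₁ := fun hk => by
      have := hu 1 (by omega)
      simp only [show 1 + 1 = 2 from rfl, e₂] at this
      exact B.reg₁.inj _ _ this
    have h₂ : 3 ≤ k → a₂ = b₂ := fun hk => by
      have := hu 2 (by omega)
      simp only [show 1 + 2 = 3 from rfl, e₃, h₁ (by omega)] at this
      exact B.reg₂.injective_mul this
    have h₃ : 4 ≤ k → a₃ = b₃ := fun hk => by
      have := hu 3 (by omega)
      simp only [show 1 + 3 = 4 from rfl, e₄, h₁ (by omega), h₂ (by omega)] at this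
      exact B.reg₃.injective_mul this
    have h₄ : 5 ≤ k → a₄ = b₄ := fun hk => by
      have := hu 4 (by omega)
      simp only [show 1 + 4 = 5 from rfl, e₅, h₁ (by omega), h₂ (by omega), h₃ (by omega)] at this
      exact B.reg₄.injective_mul this
    refine ⟨by omega, h₁, h₂, h₃, h₄, fun hk => ?_⟩
    have := hu 5 (by omega)
    simp only [show 1 + 5 = 6 from rfl, h₁ (by omega), h₂ (by omega), h₃ (by omega),
      h₄ (by omega)] at this
    exact B.reg₅.injective_mul this
  · rintro ⟨rfl, h₁, h₂, h₃, h₄, h₅⟩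
    have : k = 1 ∨ k = 2 ∨ k = 3 ∨ k = 4 ∨ k = 5 ∨ k = 6 := by omega
    rcases this with rfl | rfl | rfl | rfl | rfl | rfl
    · rw [B.smul_of_le_one _ _ _ _ _ le_rfl, B.smul_of_le_one _ _ _ _ _ le_rfl]
    · rw [e₂, e₂, h₁ (by omega)]
    · rw [e₃, e₃, h₁ (by omega), h₂ (by omega)]
    · rw [e₄, e₄, h₁ (by omega), h₂ (by omega), h₃ (by omega)]
    · rw [e₅, e₅, h₁ (by omega), h₂ (by omega), h₃ (by omega), h₄ (by omega)]
    · rw [h₁ (by omega), h₂ (by omega), h₃ (by omega), h₄ (by omega), h₅ (by omega)]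

end Branch

/-- Paths of length at most six that start with the two incident elements `x, z` and with `z, x`,
respectively, have different ends. -/
theorem IsGeneralisedHexagon.path_end_ne (hΓ : Γ.IsGeneralisedHexagon) {γ δ : ℕ → P ⊕ L} {k l : ℕ}
    (hγ : Γ.IsPath k γ) (hδ : Γ.IsPath l δ) (hk : 1 ≤ k) (hk6 : k ≤ 6) (hl : 1 ≤ l) (hl6 : l ≤ 6)
    (h₀ : γ 0 = δ 1) (h₁ : γ 1 = δ 0) : γ k ≠ δ l := by
  intro e
  -- Without its first element, `δ` starts at `γ 0` and the total length is at most eleven. If the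
  -- paths coincided, `δ` would backtrack at its start.
  obtain ⟨hkl, h⟩ := hΓ.path_unique hγ (hδ.shift 1 (m := l - 1) (by omega)) (by omega) h₀
    (by simpa only [show 1 + (l - 1) = l by omega] using e)
  exact hδ.ne 0 (by omega) (h₁.symm.trans (h 1 hk))

/-- Given two incident elements, every element is the end of a path of length at most six that
starts with these two elements, in one of the two possible orders. -/
theorem IsGeneralisedHexagon.exists_path_from (hΓ : Γ.IsGeneralisedHexagon) {x z : P ⊕ L}
    (hxz : Γ.Adj x z) (e : P ⊕ L) : ∃ n γ, 1 ≤ n ∧ n ≤ 6 ∧ Γ.IsPath n γ ∧ γ n = e ∧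
      (γ 0 = x ∧ γ 1 = z ∨ γ 0 = z ∧ γ 1 = x) := by
  obtain ⟨n, hn, γ, hγ, rfl, rfl⟩ := hΓ.exists_path x e
  by_cases h1 : 1 ≤ n ∧ γ 1 = z
  · exact ⟨n, γ, h1.1, hn, hγ, rfl, Or.inl ⟨rfl, h1.2⟩⟩
  rcases Nat.lt_or_ge n 6 with h6 | h6
  · have hp := hγ.cons hxz.symm fun h0 e => h1 ⟨h0, e.symm⟩
    exact ⟨n + 1, _, by omega, by omega, hp, rfl, Or.inr ⟨rfl, rfl⟩⟩
  · obtain rfl : n = 6 := by omega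
    -- At distance six prepending `z` would be too long, but then a path through `z` exists.
    obtain ⟨δ, hδ, h0, h1, h6⟩ := hΓ.exists_path_through ⟨γ, hγ, rfl, rfl⟩ hxz
    exact ⟨6, δ, by omega, le_rfl, hδ, h6, Or.inl ⟨h0, h1⟩⟩

section Apartment

variable {v : ZMod (2 * 6) → P ⊕ L} {A : Type*} [AddGroup A] {y : A → Γ.Collineation}

/-- The ends of the root are fixed as well, being incident with inner elements. -/
theorem rootGroup_smul_gon (hv : Γ.IsOrdinaryGon 6 v) (i : ZMod (2 * 6))
    (hy : ParametrisesSubgroup y (Γ.rootGroup fun k => v (i + (k : ℕ)))) (a : A) {j : ℕ}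
    (hj : j ≤ 6) : y a • v (i + j) = v (i + j) := by
  have hmem : y a ∈ Γ.rootGroup fun k => v (i + (k : ℕ)) := by
    have : y a ∈ Set.range y := ⟨a, rfl⟩
    rwa [hy.2.2] at this
  have hr := isRoot_of_gon hv i
  interval_cases j
  exacts [hmem 1 (by decide) (by decide) _ (hr.2 0).symm,
    hmem 2 (by decide) (by decide) _ (hr.2 1).symm,
    hmem 3 (by decide) (by decide) _ (hr.2 2).symm,
    hmem 4 (by decide) (by decide) _ (hr.2 3).symm,
    hmem 5 (by decide) (by decide) _ (hr.2 4).symm,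
    hmem 4 (by decide) (by decide) _ (hr.2 4),
    hmem 5 (by decide) (by decide) _ (hr.2 5)]

theorem rootGroup_smul_gon' (hv : Γ.IsOrdinaryGon 6 v) {i j : ZMod (2 * 6)}
    (hy : ParametrisesSubgroup y (Γ.rootGroup fun k => v (i + (k : ℕ)))) (a : A)
    (hj : (j - i).val ≤ 6) : y a • v j = v j := by
  simpa using rootGroup_smul_gon hv i hy a hj

theorem IsMoufangHexagon.movesRegularly_gon (hΓ : Γ.IsMoufangHexagon) (hv : Γ.IsOrdinaryGon 6 v)
    (i : ZMod (2 * 6)) (hy : ParametrisesSubgroup y (Γ.rootGroup fun k => v (i + (k : ℕ)))) :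
    Γ.MovesRegularly y (v (i + 1)) (v i) (v (i - 1)) := by
  have hd : Γ.Adj (v (i + 0)) (v (i - 1)) := by simpa using (hv.2 (i - 1)).symm
  have hne : v (i - 1) ≠ v (i + ((1 : ℕ) : ZMod (2 * 6))) := fun e => by
    have := hv.1 e
    rw [sub_eq_add_neg] at this
    exact absurd (add_left_cancel this) (by decide)
  have := hΓ.movesRegularly (isRoot_of_gon hv i) hy (by simpa using hd) hne
  simpa using this

theorem IsMoufangHexagon.movesRegularly_gon_end (hΓ : Γ.IsMoufangHexagon)
    (hv : Γ.IsOrdinaryGon 6 v) (i : ZMod (2 * 6))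
    (hy : ParametrisesSubgroup y (Γ.rootGroup fun k => v (i + (k : ℕ)))) :
    Γ.MovesRegularly y (v (i + 5)) (v (i + 6)) (v (i + 7)) := by
  have hd : Γ.Adj (v (i + 6)) (v (i + 7)) := by
    have := hv.2 (i + 6)
    rwa [add_assoc] at this
  have hne : v (i + 7) ≠ v (i + 5) := fun e =>
    absurd (add_left_cancel (hv.1 e)) (by decide)
  exact hΓ.movesRegularly_end (isRoot_of_gon hv i) hy hd hne

end Apartment

end PointLineGeometry

/-! ### Labels of points and lines -/

namespace HexagonLabelling

open PointLineGeometry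

variable {P L F J : Type*} [Field F] [AddCommGroup J] [Module F J]
  {Γ : PointLineGeometry P L} {H : HexagonalSystem F J} (D : HexagonLabelling Γ H)

theorem right_branch (hΓ : Γ.IsMoufangHexagon) :
    Branch Γ (fun j => D.v (6 + j)) D.x₁ D.x₂ D.x₃ D.x₄ D.x₅ where
  path := isPath_of_gon D.apartment 6 6
  fix₁ a j hj := rootGroup_smul_gon' D.apartment D.param₁ a (by interval_cases j <;> decide)
  fix₂ a j hj := rootGroup_smul_gon' D.apartment D.param₂ a (by interval_cases j <;> decide)
  fix₃ a j hj := rootGroup_smul_gon' D.apartment D.param₃ a (by interval_cases j <;> decide)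
  fix₄ a j hj := rootGroup_smul_gon' D.apartment D.param₄ a (by interval_cases j <;> decide)
  fix₅ a j hj := rootGroup_smul_gon' D.apartment D.param₅ a (by interval_cases j <;> decide)
  reg₁ := hΓ.movesRegularly_gon_end D.apartment 1 D.param₁
  reg₂ := hΓ.movesRegularly_gon_end D.apartment 2 D.param₂
  reg₃ := hΓ.movesRegularly_gon_end D.apartment 3 D.param₃
  reg₄ := hΓ.movesRegularly_gon_end D.apartment 4 D.param₄
  reg₅ := hΓ.movesRegularly_gon_end D.apartment 5 D.param₅

theorem left_branch (hΓ : Γ.IsMoufangHexagon) :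
    Branch Γ (fun j => D.v (7 - j)) D.x₆ D.x₅ D.x₄ D.x₃ D.x₂ where
  path := isPath_of_gon_neg D.apartment 7 6
  fix₁ a j hj := rootGroup_smul_gon' D.apartment D.param₆ a (by interval_cases j <;> decide)
  fix₂ a j hj := rootGroup_smul_gon' D.apartment D.param₅ a (by interval_cases j <;> decide)
  fix₃ a j hj := rootGroup_smul_gon' D.apartment D.param₄ a (by interval_cases j <;> decide)
  fix₄ a j hj := rootGroup_smul_gon' D.apartment D.param₃ a (by interval_cases j <;> decide)
  fix₅ a j hj := rootGroup_smul_gon' D.apartment D.param₂ a (by interval_cases j <;> decide)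
  reg₁ := hΓ.movesRegularly_gon D.apartment 6 D.param₆
  reg₂ := hΓ.movesRegularly_gon D.apartment 5 D.param₅
  reg₃ := hΓ.movesRegularly_gon D.apartment 4 D.param₄
  reg₄ := hΓ.movesRegularly_gon D.apartment 3 D.param₃
  reg₅ := hΓ.movesRegularly_gon D.apartment 2 D.param₂

end HexagonLabelling

namespace HexagonLabelling

open PointLineGeometry

variable {P L F J : Type*} [Field F] [AddCommGroup J] [Module F J]
  {Γ : PointLineGeometry P L} {H : HexagonalSystem F J} (D : HexagonLabelling Γ H)

/-- The element at position `k` of the path from `L₀` through `p₀` with the given coordinates. -/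
def rightElement (b : J) (u : F) (b' : J) (u' : F) (b'' : J) (k : ℕ) : P ⊕ L :=
  (D.x₁ b * D.x₂ u * D.x₃ b' * D.x₄ u' * D.x₅ b'') • D.v (6 + k)

/-- The element at position `k` of the path from `p₀` through `L₀` with the given coordinates. -/
def leftElement (t : F) (a : J) (t' : F) (a' : J) (t'' : F) (k : ℕ) : P ⊕ L :=
  (D.x₆ t * D.x₅ a * D.x₄ t' * D.x₃ a' * D.x₂ t'') • D.v (7 - k)

variable (hΓ : Γ.IsMoufangHexagon)
include hΓ

theorem rightElement_eq_iff {b c : J} {u w : F} {b' c' : J} {u' w' : F} {b'' c'' : J} {k l : ℕ}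
    (hk : 1 ≤ k) (hk6 : k ≤ 6) (hl : 1 ≤ l) (hl6 : l ≤ 6) :
    D.rightElement b u b' u' b'' k = D.rightElement c w c' w' c'' l ↔
      k = l ∧ (2 ≤ k → b = c) ∧ (3 ≤ k → u = w) ∧ (4 ≤ k → b' = c') ∧ (5 ≤ k → u' = w') ∧
        (6 ≤ k → b'' = c'') :=
  (D.right_branch hΓ).smul_eq_smul_iff hΓ.1 hk hk6 hl hl6

theorem leftElement_eq_iff {t r : F} {a c : J} {t' r' : F} {a' c' : J} {t'' r'' : F} {k l : ℕ}
    (hk : 1 ≤ k) (hk6 : k ≤ 6) (hl : 1 ≤ l) (hl6 : l ≤ 6) :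
    D.leftElement t a t' a' t'' k = D.leftElement r c r' c' r'' l ↔
      k = l ∧ (2 ≤ k → t = r) ∧ (3 ≤ k → a = c) ∧ (4 ≤ k → t' = r') ∧ (5 ≤ k → a' = c') ∧
        (6 ≤ k → t'' = r'') :=
  (D.left_branch hΓ).smul_eq_smul_iff hΓ.1 hk hk6 hl hl6

theorem rightElement_ne_leftElement {b : J} {u : F} {b' : J} {u' : F} {b'' : J} {t : F} {a : J}
    {t' : F} {a' : J} {t'' : F} {k l : ℕ} (hk : 1 ≤ k) (hk6 : k ≤ 6) (hl : 1 ≤ l) (hl6 : l ≤ 6) :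
    D.rightElement b u b' u' b'' k ≠ D.leftElement t a t' a' t'' l := by
  have hR := D.right_branch hΓ
  have hL := D.left_branch hΓ
  refine hΓ.1.path_end_ne ((hR.path.mono hk6).smul _) ((hL.path.mono hl6).smul _) hk hk6 hl hl6
    ?_ ?_
  · exact (hR.smul_of_le_one _ _ _ _ _ (j := 0) (by omega)).trans
      ((congrArg D.v (by decide)).trans
        (hL.smul_of_le_one _ _ _ _ _ (j := 1) (by omega)).symm)
  · exact (hR.smul_of_le_one _ _ _ _ _ (j := 1) (by omega)).trans
      ((congrArg D.v (by decide)).trans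
        (hL.smul_of_le_one _ _ _ _ _ (j := 0) (by omega)).symm)

theorem leftElement_ne_rightElement {b : J} {u : F} {b' : J} {u' : F} {b'' : J} {t : F} {a : J}
    {t' : F} {a' : J} {t'' : F} {k l : ℕ} (hk : 1 ≤ k) (hk6 : k ≤ 6) (hl : 1 ≤ l) (hl6 : l ≤ 6) :
    D.leftElement t a t' a' t'' l ≠ D.rightElement b u b' u' b'' k :=
  (D.rightElement_ne_leftElement hΓ hk hk6 hl hl6).symm

theorem exists_coordinates (e : P ⊕ L) : ∃ k, 1 ≤ k ∧ k ≤ 6 ∧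
    ((∃ b u b' u' b'', e = D.rightElement b u b' u' b'' k) ∨
      ∃ t a t' a' t'', e = D.leftElement t a t' a' t'' k) := by
  obtain ⟨n, γ, h1, h6, hγ, rfl, h | h⟩ := hΓ.1.exists_path_from (D.apartment.2 6) e
  · exact ⟨n, h1, h6, Or.inl ((D.right_branch hΓ).exists_eq hγ h6
      (h.1.trans (congrArg D.v (by decide))) (h.2.trans (congrArg D.v (by decide))))⟩
  · exact ⟨n, h1, h6, Or.inr ((D.left_branch hΓ).exists_eq hγ h6
      (h.1.trans (congrArg D.v (by decide))) (h.2.trans (congrArg D.v (by decide))))⟩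

omit hΓ

theorem x₁_smul (b : J) (j : ZMod (2 * 6)) (hj : (j - 1).val ≤ 6 := by decide) :
    D.x₁ b • D.v j = D.v j := rootGroup_smul_gon' D.apartment D.param₁ b hj

theorem x₂_smul (t : F) (j : ZMod (2 * 6)) (hj : (j - 2).val ≤ 6 := by decide) :
    D.x₂ t • D.v j = D.v j := rootGroup_smul_gon' D.apartment D.param₂ t hj

theorem x₃_smul (b : J) (j : ZMod (2 * 6)) (hj : (j - 3).val ≤ 6 := by decide) :
    D.x₃ b • D.v j = D.v j := rootGroup_smul_gon' D.apartment D.param₃ b hj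

theorem x₄_smul (t : F) (j : ZMod (2 * 6)) (hj : (j - 4).val ≤ 6 := by decide) :
    D.x₄ t • D.v j = D.v j := rootGroup_smul_gon' D.apartment D.param₄ t hj

theorem x₅_smul (b : J) (j : ZMod (2 * 6)) (hj : (j - 5).val ≤ 6 := by decide) :
    D.x₅ b • D.v j = D.v j := rootGroup_smul_gon' D.apartment D.param₅ b hj

theorem x₆_smul (t : F) (j : ZMod (2 * 6)) (hj : (j - 6).val ≤ 6 := by decide) :
    D.x₆ t • D.v j = D.v j := rootGroup_smul_gon' D.apartment D.param₆ t hj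

theorem inl_onPoint (g : Γ.Collineation) : Sum.inl (Collineation.onPoint g D.p₀) = g • D.v 7 := by
  rw [D.v_seven]
  rfl

theorem inr_onLine (g : Γ.Collineation) : Sum.inr (Collineation.onLine g D.L₀) = g • D.v 6 := by
  rw [D.v_six]
  rfl

variable {s₁ s₆ : Γ.Collineation} (h₁ : D.RepresentsS₁ s₁) (h₆ : D.RepresentsS₆ s₆)

include h₁ in
theorem RepresentsS₁.smul (i j : ZMod (2 * 6)) (hj : 14 - i = j := by decide) :
    s₁ • D.v i = D.v j := by
  rw [← hj]
  exact h₁ i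

include h₆ in
theorem RepresentsS₆.smul (i j : ZMod (2 * 6)) (hj : 12 - i = j := by decide) :
    s₆ • D.v i = D.v j := by
  rw [← hj]
  exact h₆ i

include h₁ h₆

/-- The labels depend on `s₁` and `s₆` only through these values; for example `s₆ s₁ s₆` takes `v 7`
to `v 5`, `v 9` and finally `v 3`. -/
theorem reflections_smul_v : s₆ • D.v 7 = D.v 5 ∧ s₁ • D.v 5 = D.v 9 ∧ s₆ • D.v 9 = D.v 3 ∧
    s₁ • D.v 3 = D.v 11 ∧ s₆ • D.v 11 = D.v 1 ∧ s₁ • D.v 6 = D.v 8 ∧ s₆ • D.v 8 = D.v 4 ∧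
    s₁ • D.v 4 = D.v 10 ∧ s₆ • D.v 10 = D.v 2 ∧ s₁ • D.v 2 = D.v 0 :=
  ⟨h₆.smul D 7 5, h₁.smul D 5 9, h₆.smul D 9 3, h₁.smul D 3 11, h₆.smul D 11 1, h₁.smul D 6 8,
    h₆.smul D 8 4, h₁.smul D 4 10, h₆.smul D 10 2, h₁.smul D 2 0⟩

omit h₁ h₆ in
theorem inl_point_infty : Sum.inl (D.point s₁ s₆ .infty) = D.v 7 := D.v_seven.symm

theorem inl_point_one (t : F) : Sum.inl (D.point s₁ s₆ (.one t)) = D.x₆ t • D.v 5 := by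
  simp only [point, inl_onPoint, mul_smul, D.reflections_smul_v h₁ h₆]

theorem inl_point_two (b : J) (u : F) :
    Sum.inl (D.point s₁ s₆ (.two b u)) = (D.x₁ b * D.x₂ u) • D.v 9 := by
  simp only [point, inl_onPoint, mul_smul, D.reflections_smul_v h₁ h₆]

theorem inl_point_three (t : F) (a : J) (t' : F) :
    Sum.inl (D.point s₁ s₆ (.three t a t')) = (D.x₆ t * D.x₅ a * D.x₄ t') • D.v 3 := by
  simp only [point, inl_onPoint, mul_smul, D.reflections_smul_v h₁ h₆]

theorem inl_point_four (b : J) (u : F) (b' : J) (u' : F) :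
    Sum.inl (D.point s₁ s₆ (.four b u b' u')) =
      (D.x₁ b * D.x₂ u * D.x₃ b' * D.x₄ u') • D.v 11 := by
  simp only [point, inl_onPoint, mul_smul, D.reflections_smul_v h₁ h₆]

theorem inl_point_five (t : F) (a : J) (t' : F) (a' : J) (t'' : F) :
    Sum.inl (D.point s₁ s₆ (.five t a t' a' t'')) =
      (D.x₆ t * D.x₅ a * D.x₄ t' * D.x₃ a' * D.x₂ t'') • D.v 1 := by
  simp only [point, inl_onPoint, mul_smul, D.reflections_smul_v h₁ h₆]

omit h₁ h₆ in
theorem inr_line_infty : Sum.inr (D.line s₁ s₆ .infty) = D.v 6 := D.v_six.symm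

theorem inr_line_one (b : J) : Sum.inr (D.line s₁ s₆ (.one b)) = D.x₁ b • D.v 8 := by
  simp only [line, inr_onLine, mul_smul, D.reflections_smul_v h₁ h₆]

theorem inr_line_two (t : F) (a : J) :
    Sum.inr (D.line s₁ s₆ (.two t a)) = (D.x₆ t * D.x₅ a) • D.v 4 := by
  simp only [line, inr_onLine, mul_smul, D.reflections_smul_v h₁ h₆]

theorem inr_line_three (b : J) (u : F) (b' : J) :
    Sum.inr (D.line s₁ s₆ (.three b u b')) = (D.x₁ b * D.x₂ u * D.x₃ b') • D.v 10 := by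
  simp only [line, inr_onLine, mul_smul, D.reflections_smul_v h₁ h₆]

theorem inr_line_four (t : F) (a : J) (t' : F) (a' : J) :
    Sum.inr (D.line s₁ s₆ (.four t a t' a')) =
      (D.x₆ t * D.x₅ a * D.x₄ t' * D.x₃ a') • D.v 2 := by
  simp only [line, inr_onLine, mul_smul, D.reflections_smul_v h₁ h₆]

theorem inr_line_five (b : J) (u : F) (b' : J) (u' : F) (b'' : J) :
    Sum.inr (D.line s₁ s₆ (.five b u b' u' b'')) =
      (D.x₁ b * D.x₂ u * D.x₃ b' * D.x₄ u' * D.x₅ b'') • D.v 0 := by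
  simp only [line, inr_onLine, mul_smul, D.reflections_smul_v h₁ h₆]

/-- Surplus coordinates disappear because `x_i` fixes `v (6 + k)` for `1 ≤ k ≤ i`. -/
theorem rightElement_eq (b : J) (u : F) (b' : J) (u' : F) (b'' : J) :
    D.rightElement b u b' u' b'' 1 = Sum.inl (D.point s₁ s₆ .infty) ∧
    D.rightElement b u b' u' b'' 2 = Sum.inr (D.line s₁ s₆ (.one b)) ∧
    D.rightElement b u b' u' b'' 3 = Sum.inl (D.point s₁ s₆ (.two b u)) ∧
    D.rightElement b u b' u' b'' 4 = Sum.inr (D.line s₁ s₆ (.three b u b')) ∧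
    D.rightElement b u b' u' b'' 5 = Sum.inl (D.point s₁ s₆ (.four b u b' u')) ∧
    D.rightElement b u b' u' b'' 6 = Sum.inr (D.line s₁ s₆ (.five b u b' u' b'')) := by
  rw [D.inl_point_infty, D.inr_line_one h₁ h₆, D.inl_point_two h₁ h₆, D.inr_line_three h₁ h₆,
    D.inl_point_four h₁ h₆, D.inr_line_five h₁ h₆]
  simp only [rightElement, show (6 + (1 : ℕ) : ZMod (2 * 6)) = 7 from by decide,
    show (6 + (2 : ℕ) : ZMod (2 * 6)) = 8 from by decide,
    show (6 + (3 : ℕ) : ZMod (2 * 6)) = 9 from by decide,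
    show (6 + (4 : ℕ) : ZMod (2 * 6)) = 10 from by decide,
    show (6 + (5 : ℕ) : ZMod (2 * 6)) = 11 from by decide,
    show (6 + (6 : ℕ) : ZMod (2 * 6)) = 0 from by decide]
  simp only [mul_smul, D.x₅_smul _ 7, D.x₄_smul _ 7, D.x₃_smul _ 7, D.x₂_smul _ 7, D.x₁_smul _ 7,
    D.x₅_smul _ 8, D.x₄_smul _ 8, D.x₃_smul _ 8, D.x₂_smul _ 8,
    D.x₅_smul _ 9, D.x₄_smul _ 9, D.x₃_smul _ 9, D.x₅_smul _ 10, D.x₄_smul _ 10, D.x₅_smul _ 11,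
    and_self]

theorem leftElement_eq (t : F) (a : J) (t' : F) (a' : J) (t'' : F) :
    D.leftElement t a t' a' t'' 1 = Sum.inr (D.line s₁ s₆ .infty) ∧
    D.leftElement t a t' a' t'' 2 = Sum.inl (D.point s₁ s₆ (.one t)) ∧
    D.leftElement t a t' a' t'' 3 = Sum.inr (D.line s₁ s₆ (.two t a)) ∧
    D.leftElement t a t' a' t'' 4 = Sum.inl (D.point s₁ s₆ (.three t a t')) ∧
    D.leftElement t a t' a' t'' 5 = Sum.inr (D.line s₁ s₆ (.four t a t' a')) ∧
    D.leftElement t a t' a' t'' 6 = Sum.inl (D.point s₁ s₆ (.five t a t' a' t'')) := by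
  rw [D.inr_line_infty, D.inl_point_one h₁ h₆, D.inr_line_two h₁ h₆, D.inl_point_three h₁ h₆,
    D.inr_line_four h₁ h₆, D.inl_point_five h₁ h₆]
  simp only [leftElement, show (7 - (1 : ℕ) : ZMod (2 * 6)) = 6 from by decide,
    show (7 - (2 : ℕ) : ZMod (2 * 6)) = 5 from by decide,
    show (7 - (3 : ℕ) : ZMod (2 * 6)) = 4 from by decide,
    show (7 - (4 : ℕ) : ZMod (2 * 6)) = 3 from by decide,
    show (7 - (5 : ℕ) : ZMod (2 * 6)) = 2 from by decide,
    show (7 - (6 : ℕ) : ZMod (2 * 6)) = 1 from by decide]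
  simp only [mul_smul, D.x₂_smul _ 6, D.x₃_smul _ 6, D.x₄_smul _ 6, D.x₅_smul _ 6, D.x₆_smul _ 6,
    D.x₂_smul _ 5, D.x₃_smul _ 5, D.x₄_smul _ 5, D.x₅_smul _ 5,
    D.x₂_smul _ 4, D.x₃_smul _ 4, D.x₄_smul _ 4, D.x₂_smul _ 3, D.x₃_smul _ 3, D.x₂_smul _ 2,
    and_self]

include hΓ

set_option linter.unnecessarySimpa false in
theorem point_injective : Function.Injective (D.point s₁ s₆) := by
  intro p q h
  replace h : (Sum.inl (D.point s₁ s₆ p) : P ⊕ L) = Sum.inl (D.point s₁ s₆ q) := by rw [h]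
  have hR := fun b u b' u' b'' => D.rightElement_eq h₁ h₆ b u b' u' b''
  have hL := fun t a t' a' t'' => D.leftElement_eq h₁ h₆ t a t' a' t''
  -- The zeros are dummies for coordinates that do not affect the element.
  have i1 := (hR 0 0 0 0 0).1.symm
  have i2 := fun b u => (hR b u 0 0 0).2.2.1.symm
  have i3 := fun b u b' u' => (hR b u b' u' 0).2.2.2.2.1.symm
  have i4 := fun t => (hL t 0 0 0 0).2.1.symm
  have i5 := fun t a t' => (hL t a t' 0 0).2.2.2.1.symm
  have i6 := fun t a t' a' t'' => (hL t a t' a' t'').2.2.2.2.2.symm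
  cases p <;> cases q <;>
    simpa [i1, i2, i3, i4, i5, i6, D.rightElement_eq_iff hΓ, D.leftElement_eq_iff hΓ,
      D.rightElement_ne_leftElement hΓ, D.leftElement_ne_rightElement hΓ] using h

set_option linter.unnecessarySimpa false in
theorem line_injective : Function.Injective (D.line s₁ s₆) := by
  intro p q h
  replace h : (Sum.inr (D.line s₁ s₆ p) : P ⊕ L) = Sum.inr (D.line s₁ s₆ q) := by rw [h]
  have hR := fun b u b' u' b'' => D.rightElement_eq h₁ h₆ b u b' u' b''
  have hL := fun t a t' a' t'' => D.leftElement_eq h₁ h₆ t a t' a' t''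
  have i1 := (hL 0 0 0 0 0).1.symm
  have i2 := fun t a => (hL t a 0 0 0).2.2.1.symm
  have i3 := fun t a t' a' => (hL t a t' a' 0).2.2.2.2.1.symm
  have i4 := fun b => (hR b 0 0 0 0).2.1.symm
  have i5 := fun b u b' => (hR b u b' 0 0).2.2.2.1.symm
  have i6 := fun b u b' u' b'' => (hR b u b' u' b'').2.2.2.2.2.symm
  cases p <;> cases q <;>
    simpa [i1, i2, i3, i4, i5, i6, D.rightElement_eq_iff hΓ, D.leftElement_eq_iff hΓ,
      D.rightElement_ne_leftElement hΓ, D.leftElement_ne_rightElement hΓ] using h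

theorem exists_label (e : P ⊕ L) :
    (∃ p, e = Sum.inl (D.point s₁ s₆ p)) ∨ ∃ l, e = Sum.inr (D.line s₁ s₆ l) := by
  obtain ⟨k, hk, hk6, ⟨b, u, b', u', b'', rfl⟩ | ⟨t, a, t', a', t'', rfl⟩⟩ :=
    D.exists_coordinates hΓ e
  · obtain ⟨e1, e2, e3, e4, e5, e6⟩ := D.rightElement_eq h₁ h₆ b u b' u' b''
    interval_cases k
    exacts [.inl ⟨_, e1⟩, .inr ⟨_, e2⟩, .inl ⟨_, e3⟩, .inr ⟨_, e4⟩, .inl ⟨_, e5⟩, .inr ⟨_, e6⟩]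
  · obtain ⟨e1, e2, e3, e4, e5, e6⟩ := D.leftElement_eq h₁ h₆ t a t' a' t''
    interval_cases k
    exacts [.inr ⟨_, e1⟩, .inl ⟨_, e2⟩, .inr ⟨_, e3⟩, .inl ⟨_, e4⟩, .inr ⟨_, e5⟩, .inl ⟨_, e6⟩]

theorem point_bijective : Function.Bijective (D.point s₁ s₆) := by
  refine ⟨D.point_injective hΓ h₁ h₆, fun p => ?_⟩
  obtain ⟨q, hq⟩ | ⟨l, hl⟩ := D.exists_label hΓ h₁ h₆ (Sum.inl p)
  · exact ⟨q, (Sum.inl_injective hq).symm⟩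
  · simp at hl

theorem line_bijective : Function.Bijective (D.line s₁ s₆) := by
  refine ⟨D.line_injective hΓ h₁ h₆, fun l => ?_⟩
  obtain ⟨q, hq⟩ | ⟨m, hm⟩ := D.exists_label hΓ h₁ h₆ (Sum.inr l)
  · simp at hq
  · exact ⟨m, (Sum.inr_injective hm).symm⟩

/-! ### Incidence in terms of labels -/

theorem inc_infty_iff (m : L) : Γ.Inc (D.point s₁ s₆ .infty) m ↔
    m = D.line s₁ s₆ .infty ∨ ∃ b, m = D.line s₁ s₆ (.one b) := by
  have := (D.right_branch hΓ).reg₁.adj_smul_iff 1 (Sum.inr m)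
  change Γ.Adj ((1 : Γ.Collineation) • D.v 7) _ ↔
    _ = (1 : Γ.Collineation) • D.v 6 ∨ ∃ a, _ = (1 * D.x₁ a) • D.v 8 at this
  simp only [one_smul, one_mul, ← D.inl_point_infty (s₁ := s₁) (s₆ := s₆), ← D.inr_line_one h₁ h₆,
    ← D.inr_line_infty (s₁ := s₁) (s₆ := s₆), Sum.inr.injEq] at this
  exact this

theorem inc_one_iff (t : F) (m : L) : Γ.Inc (D.point s₁ s₆ (.one t)) m ↔
    m = D.line s₁ s₆ .infty ∨ ∃ a, m = D.line s₁ s₆ (.two t a) := by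
  have := (D.left_branch hΓ).reg₂.adj_smul_iff (D.x₆ t) (Sum.inr m)
  change Γ.Adj (D.x₆ t • D.v 5) _ ↔ _ = D.x₆ t • D.v 6 ∨ ∃ a, _ = (D.x₆ t * D.x₅ a) • D.v 4 at this
  rw [D.x₆_smul _ 6] at this
  simp only [← D.inl_point_one h₁ h₆, ← D.inr_line_two h₁ h₆,
    ← D.inr_line_infty (s₁ := s₁) (s₆ := s₆), Sum.inr.injEq] at this
  exact this

theorem inc_two_iff (b : J) (u : F) (m : L) : Γ.Inc (D.point s₁ s₆ (.two b u)) m ↔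
    m = D.line s₁ s₆ (.one b) ∨ ∃ b', m = D.line s₁ s₆ (.three b u b') := by
  have := (D.right_branch hΓ).reg₃.adj_smul_iff (D.x₁ b * D.x₂ u) (Sum.inr m)
  change Γ.Adj ((D.x₁ b * D.x₂ u) • D.v 9) _ ↔ _ = (D.x₁ b * D.x₂ u) • D.v 8 ∨
    ∃ a, _ = (D.x₁ b * D.x₂ u * D.x₃ a) • D.v 10 at this
  simp only [mul_smul _ _ (D.v 8), D.x₂_smul _ 8, ← D.inl_point_two h₁ h₆,
    ← D.inr_line_one h₁ h₆, ← D.inr_line_three h₁ h₆, Sum.inr.injEq] at this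
  exact this

theorem inc_three_iff (t : F) (a : J) (t' : F) (m : L) : Γ.Inc (D.point s₁ s₆ (.three t a t')) m ↔
    m = D.line s₁ s₆ (.two t a) ∨ ∃ a', m = D.line s₁ s₆ (.four t a t' a') := by
  have := (D.left_branch hΓ).reg₄.adj_smul_iff (D.x₆ t * D.x₅ a * D.x₄ t') (Sum.inr m)
  change Γ.Adj ((D.x₆ t * D.x₅ a * D.x₄ t') • D.v 3) _ ↔
    _ = (D.x₆ t * D.x₅ a * D.x₄ t') • D.v 4 ∨
    ∃ a', _ = (D.x₆ t * D.x₅ a * D.x₄ t' * D.x₃ a') • D.v 2 at this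
  simp only [mul_smul _ _ (D.v 4), D.x₄_smul _ 4, ← D.inl_point_three h₁ h₆,
    ← D.inr_line_four h₁ h₆] at this
  simp only [← mul_smul, ← D.inr_line_two h₁ h₆, Sum.inr.injEq] at this
  exact this

theorem inc_four_iff (b : J) (u : F) (b' : J) (u' : F) (m : L) :
    Γ.Inc (D.point s₁ s₆ (.four b u b' u')) m ↔
      m = D.line s₁ s₆ (.three b u b') ∨ ∃ b'', m = D.line s₁ s₆ (.five b u b' u' b'') := by
  have := (D.right_branch hΓ).reg₅.adj_smul_iff (D.x₁ b * D.x₂ u * D.x₃ b' * D.x₄ u') (Sum.inr m)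
  change Γ.Adj ((D.x₁ b * D.x₂ u * D.x₃ b' * D.x₄ u') • D.v 11) _ ↔
    _ = (D.x₁ b * D.x₂ u * D.x₃ b' * D.x₄ u') • D.v 10 ∨
    ∃ b'', _ = (D.x₁ b * D.x₂ u * D.x₃ b' * D.x₄ u' * D.x₅ b'') • D.v 0 at this
  simp only [mul_smul _ _ (D.v 10), D.x₄_smul _ 10, ← D.inl_point_four h₁ h₆,
    ← D.inr_line_five h₁ h₆] at this
  simp only [← mul_smul, ← D.inr_line_three h₁ h₆, Sum.inr.injEq] at this
  exact this

/-- The left branch ends at `v 1`, where `U₁` acts from the start of its root, fixing `v 2` and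
moving `v 0`. After `reorder` the trailing `x₆ t` is absorbed by `v 0`, leaving a labelled line. -/
theorem inc_five_iff (t : F) (a : J) (t' : F) (a' : J) (t'' : F) (m : L) :
    Γ.Inc (D.point s₁ s₆ (.five t a t' a' t'')) m ↔
      m = D.line s₁ s₆ (.four t a t' a') ∨
      ∃ b, m = D.line s₁ s₆ (.five b (t'' + t * H.N b - H.T a' b + H.T a (H.sharp b))
        (a' - H.cross a b - t • H.sharp b)
        (t' + t ^ 2 * H.N b - t * t'' + t * H.T a (H.sharp b) + H.T (H.sharp a) b - H.T a a')
        (a + t • b)) := by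
  have := (hΓ.movesRegularly_gon D.apartment 1 D.param₁).adj_smul_iff
    (D.x₆ t * D.x₅ a * D.x₄ t' * D.x₃ a' * D.x₂ t'') (Sum.inr m)
  change Γ.Adj ((D.x₆ t * D.x₅ a * D.x₄ t' * D.x₃ a' * D.x₂ t'') • D.v 1) _ ↔
    _ = (D.x₆ t * D.x₅ a * D.x₄ t' * D.x₃ a' * D.x₂ t'') • D.v 2 ∨
    ∃ b, _ = (D.x₆ t * D.x₅ a * D.x₄ t' * D.x₃ a' * D.x₂ t'' * D.x₁ b) • D.v 0 at this
  simp only [D.reorder, mul_smul _ (D.x₂ _) (D.v 2), mul_smul _ (D.x₆ _) (D.v 0), D.x₂_smul _ 2,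
    D.x₆_smul _ 0, ← D.inl_point_five h₁ h₆, ← D.inr_line_five h₁ h₆, ← D.inr_line_four h₁ h₆,
    Sum.inr.injEq] at this
  exact this

theorem inc_iff_chainIncident (p : PointLabel F J) (l : LineLabel F J)
    (hpl : ¬ (p.IsGeneric ∧ l.IsGeneric)) :
    Γ.Inc (D.point s₁ s₆ p) (D.line s₁ s₆ l) ↔ ChainIncident p l := by
  have hinj := D.line_injective hΓ h₁ h₆
  cases p with
  | infty =>
    rw [D.inc_infty_iff hΓ h₁ h₆]
    simp only [hinj.eq_iff]
    constructor
    · rintro (rfl | ⟨b, rfl⟩) <;> constructor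
    · rintro (_ | _) <;> simp
  | one t =>
    rw [D.inc_one_iff hΓ h₁ h₆]
    simp only [hinj.eq_iff]
    constructor
    · rintro (rfl | ⟨b, rfl⟩) <;> constructor
    · rintro (_ | _) <;> simp
  | two b u =>
    rw [D.inc_two_iff hΓ h₁ h₆]
    simp only [hinj.eq_iff]
    constructor
    · rintro (rfl | ⟨b, rfl⟩) <;> constructor
    · rintro (_ | _) <;> simp
  | three t a t' =>
    rw [D.inc_three_iff hΓ h₁ h₆]
    simp only [hinj.eq_iff]
    constructor
    · rintro (rfl | ⟨b, rfl⟩) <;> constructor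
    · rintro (_ | _) <;> simp
  | four b u b' u' =>
    rw [D.inc_four_iff hΓ h₁ h₆]
    simp only [hinj.eq_iff]
    constructor
    · rintro (rfl | ⟨b, rfl⟩) <;> constructor
    · rintro (_ | _) <;> simp
  | five t a t' a' t'' =>
    rw [D.inc_five_iff hΓ h₁ h₆]
    simp only [hinj.eq_iff]
    constructor
    · rintro (rfl | ⟨b, rfl⟩)
      · constructor
      · exact (hpl ⟨trivial, trivial⟩).elim
    · rintro (_ | _)
      simp

theorem inc_five_five_iff (t t' t'' u u' : F) (a a' b b' b'' : J) :
    Γ.Inc (D.point s₁ s₆ (.five t a t' a' t'')) (D.line s₁ s₆ (.five b u b' u' b'')) ↔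
      (u = t'' + t * H.N b - H.T a' b + H.T a (H.sharp b) ∧
       b' = a' - H.cross a b - t • H.sharp b ∧
       u' = t' + t ^ 2 * H.N b - t * t'' + t * H.T a (H.sharp b) + H.T (H.sharp a) b
         - H.T a a' ∧
       b'' = a + t • b) := by
  rw [D.inc_five_iff hΓ h₁ h₆]
  simp only [(D.line_injective hΓ h₁ h₆).eq_iff, reduceCtorEq, false_or, LineLabel.five.injEq]
  constructor
  · rintro ⟨c, rfl, h⟩
    exact h
  · exact fun h => ⟨b, rfl, h⟩

end HexagonLabelling

theorem mainTheorem10 {P L F J : Type*} [Field F] [AddCommGroup J] [Module F J]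
    (Γ : PointLineGeometry P L) (hΓ : Γ.IsMoufangHexagon)
    (H : HexagonalSystem F J) (D : HexagonLabelling Γ H) :
    (∃ s₁, D.RepresentsS₁ s₁) ∧ (∃ s₆, D.RepresentsS₆ s₆) ∧
    ∀ s₁ s₆ : Γ.Collineation, D.RepresentsS₁ s₁ → D.RepresentsS₆ s₆ →
      Function.Bijective (D.point s₁ s₆) ∧ Function.Bijective (D.line s₁ s₆) ∧
      (∀ (p : PointLabel F J) (l : LineLabel F J), ¬ (p.IsGeneric ∧ l.IsGeneric) →
        (Γ.Inc (D.point s₁ s₆ p) (D.line s₁ s₆ l) ↔ ChainIncident p l)) ∧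
      ∀ (t t' t'' u u' : F) (a a' b b' b'' : J),
        (Γ.Inc (D.point s₁ s₆ (.five t a t' a' t'')) (D.line s₁ s₆ (.five b u b' u' b'')) ↔
          (u = t'' + t * H.N b - H.T a' b + H.T a (H.sharp b) ∧
           b' = a' - H.cross a b - t • H.sharp b ∧
           u' = t' + t ^ 2 * H.N b - t * t'' + t * H.T a (H.sharp b) + H.T (H.sharp a) b
             - H.T a a' ∧
           b'' = a + t • b)) ∧
        (Γ.Inc (D.point s₁ s₆ (.five t a t' a' t'')) (D.line s₁ s₆ (.five b u b' u' b'')) ↔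
          (a = b'' - t • b ∧
           t' = u' + t ^ 2 * H.N b + u * t - t * H.T b'' (H.sharp b) + H.T b' b''
             + H.T (H.sharp b'') b ∧
           a' = b' + H.cross b b'' - t • H.sharp b ∧
           t'' = u - t * H.N b + H.T b b' + H.T b'' (H.sharp b))) := by
  refine ⟨?_, ?_, fun s₁ s₆ h₁ h₆ => ⟨D.point_bijective hΓ h₁ h₆, D.line_bijective hΓ h₁ h₆,
    D.inc_iff_chainIncident hΓ h₁ h₆, fun t t' t'' u u' a a' b b' b'' => ?_⟩⟩
  · obtain ⟨s, hs⟩ := hΓ.exists_reflection D.apartment 7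
    exact ⟨s, hs⟩
  · obtain ⟨s, hs⟩ := hΓ.exists_reflection D.apartment 6
    exact ⟨s, hs⟩
  · have h := D.inc_five_five_iff hΓ h₁ h₆ t t' t'' u u' a a' b b' b''
    exact ⟨h, h.trans (H.system_iff t t' t'' u u' a a' b b' b'')⟩
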